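/- **Soundness of non-idempotent intersection types for $\lambda lxr$.** Every $\lambda lxr$-term that is typable with an $A$-type is strongly normalising for the full $\lambda lxr$-reduction modulo its equivalences: if $M$ is a $\lambda lxr$-term and $\Gamma\vdash M:A$ for a context $\Gamma$ and an $A$-type $A$, then $M\in SN_{\lambda lxr}$. The notions are as follows. *Terms.* $M,N ::= x \mid \lambda x.M \mid MN \mid M\langle x{:=}N\rangle \mid W_x(M)\mid C_x^{y,z}(M)$ (explicit substitution, weakening, contraction), up to $\alpha$-equivalence and with Barendregt's variable convention; $x$ is bound in $M$ in $\lambda x.M$ and $M\langle x{:=}N\rangle$, and $y,z$ are bound in $M$ in $C_x^{y,z}(M)$. Free variables are as expected, with $fv(W_x(M))=fv(M)\cup\{x\}$, $fv(C_x^{y,z}(M))=(fv(M)\setminus\{y,z\})\cup\{x\}$ if $y\in fv(M)$ or $z\in fv(M)$, and $fv(C_x^{y,z}(M))=fv(M)$ otherwise. A $\lambda lxr$-term is a *linear* term: variables are linear; $MN$ is linear if $M,N$ are and $fv(M)\cap fv(N)=\varnothing$; $\lambda x.M$ if $M$ is and $x\in fv(M)$; $M\langle x{:=}N\rangle$ if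 $M,N$ are, $x\in fv(M)$ and $(fv(M)\setminus\{x\})\cap fv(N)=\varnothing$; $W_x(M)$ if $M$ is and $x\notin fv(M)$; $C_x^{y,z}(M)$ if $M$ is, $y\neq z$, $y,z\in fv(M)$ and $x\notin fv(M)$. *Types.* $F::=\tau\mid A\to F$, $A::=F\mid A\cap B$, $U::=A\mid\omega$, with $\tau$ ranging over a countably infinite set of atoms; $\cap$ is extended to $U$-types with $\omega$ neutral. $\approx$ is the equivalence on $U$-types generated by commutativity, associativity and congruence of $\cap$ at the surface of types (not under arrows). $U\subseteq V$ means $U\approx V\cap U'$ for some $U'$. A context is a map from variables to $U$-types that is $\omega$ outside a finite set; $\cap$ on contexts is pointwise; $\Gamma,x{:}U$ extends a context with $\Gamma(x)=\omega$. *Typing rules.* - $x{:}F\vdash x:F$; and $\vdash M:\omega$ in the empty context. - If $\Gamma,x{:}U\vdash M:F$ and $A\subseteq U$, then $\Gamma\vdash\lambda x.M:A\to F$. - If $\Gamma\vdash M:A\to F$ and $\Delta\vdash N:A$, then $\Gamma\cap\Delta\vdash MN:F$. - If $\Gamma\vdash M:A$ and $\Delta\vdash M:B$, then $\Gamma\cap\Delta\vdash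 M:A\cap B$. - If $\Gamma\vdash N:A$, $\Delta,x{:}U\vdash M:F$ and $U=A$ or $U=\omega$, then $\Gamma\cap\Delta\vdash M\langle x{:=}N\rangle:F$. - If $\Gamma,x{:}U,y{:}V_1,z{:}V_2\vdash M:F$, then $\Gamma,x{:}U\cap(V_1\cap V_2)\vdash C_x^{y,z}(M):F$. - If $\Gamma,x{:}U\vdash M:F$, then $\Gamma,x{:}U\cap A\vdash W_x(M):F$. *Equivalence.* $\equiv$ is the least congruence containing $\alpha$-equivalence and - $C_w^{x,v}(C_x^{z,y}(M))\equiv C_w^{x,y}(C_x^{z,v}(M))$ if $x\ne y,v$; $\ C_x^{y,z}(M)\equiv C_x^{z,y}(M)$; - $C_{x'}^{y',z'}(C_x^{y,z}(M))\equiv C_x^{y,z}(C_{x'}^{y',z'}(M))$ if $x\neq y',z'$ and $x'\ne y,z$; - $W_x(W_y(M))\equiv W_y(W_x(M))$; - $M\langle x{:=}N_1\rangle\langle y{:=}N_2\rangle\equiv M\langle y{:=}N_2\rangle\langle x{:=}N_1\rangle$ if $y\notin fv(N_1)$, $x\notin fv(N_2)$; - $C_w^{y,z}(M)\langle x{:=}N\rangle\equiv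 C_w^{y,z}(M\langle x{:=}N\rangle)$ if $x\ne w$ and $y,z\notin fv(N)$. *Reduction rules.* - (B) $(\lambda x.M)N\to M\langle x{:=}N\rangle$; (SR) $x\langle x{:=}N\rangle\to N$; - (SP) $(M_1M_2)\langle x{:=}N\rangle\to M_1\langle x{:=}N\rangle\,M_2$ if $x\in fv(M_1)$, and $\to M_1\,(M_2\langle x{:=}N\rangle)$ if $x\in fv(M_2)$; $(\lambda y.M)\langle x{:=}N\rangle\to\lambda y.M\langle x{:=}N\rangle$ if $x\neq y$, $y\notin fv(N)$; $W_y(M)\langle x{:=}N\rangle\to W_y(M\langle x{:=}N\rangle)$ if $x\ne y$; $M_1\langle y{:=}M_2\rangle\langle x{:=}N\rangle\to M_1\langle y{:=}M_2\langle x{:=}N\rangle\rangle$ if $x\in fv(M_2)$; - (W) $W_x(M)\langle x{:=}N\rangle\to W_{fv(N)}(M)$; - (D) $C_x^{y,z}(M)\langle x{:=}N\rangle\to C_X^{Y,Z}(M\langle y{:=}N_1\rangle\langle z{:=}N_2\rangle)$, where $X=fv(N)$, $Y,Z$ are disjoint sets of fresh variables in bijection with $X$, and $N_1,N_2$ are $N$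 with $X$ renamed to $Y$, respectively to $Z$; - $\lambda x.W_y(M)\to W_y(\lambda x.M)$ if $x\neq y$; $W_y(M)N\to W_y(MN)$; $M\,W_y(N)\to W_y(MN)$; $M\langle x{:=}W_y(N)\rangle\to W_y(M\langle x{:=}N\rangle)$; - (Merge) $C_w^{y,z}(W_y(M))\to M\{z:=w\}$ (renaming of $z$ by $w$); (Cross) $C_w^{y,z}(W_x(M))\to W_x(C_w^{y,z}(M))$ if $x\ne y,z$; - $C_w^{y,z}(\lambda x.M)\to\lambda x.C_w^{y,z}(M)$; $C_w^{y,z}(MN)\to C_w^{y,z}(M)N$ if $y,z\in fv(M)$, and $\to M\,C_w^{y,z}(N)$ if $y,z\in fv(N)$; $C_w^{y,z}(M\langle x{:=}N\rangle)\to M\langle x{:=}C_w^{y,z}(N)\rangle$ if $y,z\in fv(N)$. The reduction relation is the closure of all these rules under all term constructors, taken modulo $\equiv$: $M$ reduces to $M'$ when $M\equiv P$, $P$ rewrites to $Q$ by one rule applied to one subterm, and $Q\equiv M'$. $SN_{\lambda lxr}$ is the set of terms with no infinite reduction sequence. -/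

import Mathlib

namespace Lxr

/-! ## Terms

Variables are natural numbers. Terms are written with named binders; `α`-equivalence is part of
the equivalence `Term.Equiv` modulo which terms are reduced. -/

/-- `lam x M` is `λx.M`; `sub M x N` is the explicit substitution `⟨N/x⟩M` (binding `x` in `M`);
`weak x M` is the weakening `W_x(M)`; `contr x y z M` is the contraction `C_x^{y,z}(M)`
(binding `y` and `z` in `M`). -/
inductive Term : Type
  | var (x : ℕ)
  | lam (x : ℕ) (M : Term)
  | app (M N : Term)
  | sub (M : Term) (x : ℕ) (N : Term)
  | weak (x : ℕ) (M : Term)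
  | contr (x y z : ℕ) (M : Term)

namespace Term

/-- Free variables. -/
def fv : Term → Finset ℕ
  | var x => {x}
  | lam x M => fv M \ {x}
  | app M N => fv M ∪ fv N
  | sub M x N => (fv M \ {x}) ∪ fv N
  | weak x M => fv M ∪ {x}
  | contr x y z M =>
      if y ∈ fv M ∨ z ∈ fv M then (fv M \ {y, z}) ∪ {x} else fv M

/-- Linear terms, i.e. the terms of the calculus `λlxr`. -/
inductive Linear : Term → Prop
  | var (x : ℕ) : Linear (var x)
  | app {M N : Term} : Linear M → Linear N → Disjoint (fv M) (fv N) → Linear (app M N)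
  | lam {x : ℕ} {M : Term} : Linear M → x ∈ fv M → Linear (lam x M)
  | sub {M : Term} {x : ℕ} {N : Term} : Linear M → Linear N → x ∈ fv M →
      Disjoint (fv M \ {x}) (fv N) → Linear (sub M x N)
  | weak {x : ℕ} {M : Term} : Linear M → x ∉ fv M → Linear (weak x M)
  | contr {x y z : ℕ} {M : Term} : Linear M → y ≠ z → y ∈ fv M → z ∈ fv M → x ∉ fv M →
      Linear (contr x y z M)

/-- Apply a permutation of the variables to all names, free and bound, of a term. -/
def perm (π : Equiv.Perm ℕ) : Term → Term
  | var x => var (π x)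
  | lam x M => lam (π x) (perm π M)
  | app M N => app (perm π M) (perm π N)
  | sub M x N => sub (perm π M) (π x) (perm π N)
  | weak x M => weak (π x) (perm π M)
  | contr x y z M => contr (π x) (π y) (π z) (perm π M)

/-- `swap a b M` exchanges the names `a` and `b` in `M`. When `b` is not free in `M` this is, up
to `α`-equivalence, the capture-avoiding renaming of `a` by `b` in `M`. -/
def swap (a b : ℕ) (M : Term) : Term := perm (Equiv.swap a b) M

/-- Iterated `swap`. When the `aᵢ` are distinct, the `bᵢ` are distinct, distinct from the `aⱼ`
and not free in `M`, this is the simultaneous renaming of each `aᵢ` by `bᵢ` in `M`. -/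
def swaps (L : List (ℕ × ℕ)) (M : Term) : Term := L.foldr (fun p P => swap p.1 p.2 P) M

/-- `W_{x₁}(… W_{xₙ}(M))`. -/
def weaks (X : List ℕ) (M : Term) : Term := X.foldr weak M

/-- `C_{x₁}^{y₁,z₁}(… C_{xₙ}^{yₙ,zₙ}(M))`, for a list of triples `(xᵢ, yᵢ, zᵢ)`. -/
def contrs (L : List (ℕ × ℕ × ℕ)) (M : Term) : Term :=
  L.foldr (fun t P => contr t.1 t.2.1 t.2.2 P) M

/-- Closure of a relation under all term constructors (one position at a time). -/
inductive Ctxt (R : Term → Term → Prop) : Term → Term → Prop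
  | base {M M' : Term} : R M M' → Ctxt R M M'
  | lam (x : ℕ) {M M' : Term} : Ctxt R M M' → Ctxt R (lam x M) (lam x M')
  | appL {M M' : Term} (N : Term) : Ctxt R M M' → Ctxt R (app M N) (app M' N)
  | appR (M : Term) {N N' : Term} : Ctxt R N N' → Ctxt R (app M N) (app M N')
  | subL {M M' : Term} (x : ℕ) (N : Term) : Ctxt R M M' → Ctxt R (sub M x N) (sub M' x N)
  | subR (M : Term) (x : ℕ) {N N' : Term} : Ctxt R N N' → Ctxt R (sub M x N) (sub M x N')
  | weak (x : ℕ) {M M' : Term} : Ctxt R M M' → Ctxt R (weak x M) (weak x M')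
  | contr (x y z : ℕ) {M M' : Term} : Ctxt R M M' → Ctxt R (contr x y z M) (contr x y z M')

/-- Elementary renamings of one bound variable; they generate `α`-equivalence. By
the variable convention, the names `x`, `y`, `z` of a contraction `C_x^{y,z}` are distinct. -/
inductive AlphaRule : Term → Term → Prop
  | lam {x x' : ℕ} {M : Term} : x' ∉ fv M → AlphaRule (lam x M) (lam x' (swap x x' M))
  | sub {x x' : ℕ} {M N : Term} : x' ∉ fv M → AlphaRule (sub M x N) (sub (swap x x' M) x' N)
  | contrL {x y y' z : ℕ} {M : Term} : x ≠ y → x ≠ z → y ≠ z → y' ∉ fv M → y' ≠ x → y' ≠ z →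
      AlphaRule (contr x y z M) (contr x y' z (swap y y' M))
  | contrR {x y z z' : ℕ} {M : Term} : x ≠ y → x ≠ z → y ≠ z → z' ∉ fv M → z' ≠ x → z' ≠ y →
      AlphaRule (contr x y z M) (contr x y z' (swap z z' M))

/-- The equivalence rules of `λlxr`. -/
inductive EquivRule : Term → Term → Prop
  /-- `ACC`: associativity of contraction. The conditions on `w` are the variable convention. -/
  | accAssoc {w x v z y : ℕ} {M : Term} : x ≠ y → x ≠ v → w ≠ y → w ≠ v →
      EquivRule (contr w x v (contr x z y M)) (contr w x y (contr x z v M))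
  /-- `ACC`: commutativity of contraction. -/
  | accComm {x y z : ℕ} {M : Term} : EquivRule (contr x y z M) (contr x z y M)
  /-- `ACC`: independent contractions commute. -/
  | accSwap {x y z x' y' z' : ℕ} {M : Term} : x ≠ y' → x ≠ z' → x' ≠ y → x' ≠ z →
      EquivRule (contr x' y' z' (contr x y z M)) (contr x y z (contr x' y' z' M))
  /-- `ACW`. -/
  | acw {x y : ℕ} {M : Term} : EquivRule (weak x (weak y M)) (weak y (weak x M))
  /-- `CS`: independent substitutions commute. -/
  | csSub {x y : ℕ} {M N₁ N₂ : Term} : y ∉ fv N₁ → x ∉ fv N₂ →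
      EquivRule (sub (sub M x N₁) y N₂) (sub (sub M y N₂) x N₁)
  /-- `CS`: a substitution and an independent contraction commute. -/
  | csContr {w y z x : ℕ} {M N : Term} : x ≠ w → y ∉ fv N → z ∉ fv N →
      EquivRule (sub (contr w y z M) x N) (contr w y z (sub M x N))

/-- The congruence `≡`: the least congruence (equivalence relation closed under the term
constructors) containing `α`-equivalence and the equivalence rules. -/
def Equiv : Term → Term → Prop :=
  Relation.EqvGen (Ctxt fun M M' => AlphaRule M M' ∨ EquivRule M M')

/-- The reduction rules of `λlxr`. -/
inductive RedRule : Term → Term → Prop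
  | B {x : ℕ} {M N : Term} : RedRule (app (lam x M) N) (sub M x N)
  | SR {x : ℕ} {N : Term} : RedRule (sub (var x) x N) N
  | SPApp1 {x : ℕ} {M₁ M₂ N : Term} : x ∈ fv M₁ →
      RedRule (sub (app M₁ M₂) x N) (app (sub M₁ x N) M₂)
  | SPApp2 {x : ℕ} {M₁ M₂ N : Term} : x ∈ fv M₂ →
      RedRule (sub (app M₁ M₂) x N) (app M₁ (sub M₂ x N))
  | SPLam {x y : ℕ} {M N : Term} : x ≠ y → y ∉ fv N →
      RedRule (sub (lam y M) x N) (lam y (sub M x N))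
  | SPWeak {x y : ℕ} {M N : Term} : x ≠ y →
      RedRule (sub (weak y M) x N) (weak y (sub M x N))
  | SPSub {x y : ℕ} {M₁ M₂ N : Term} : x ∈ fv M₂ →
      RedRule (sub (sub M₁ y M₂) x N) (sub M₁ y (sub M₂ x N))
  /-- `X` enumerates the free variables of `N` without repetition. -/
  | W {x : ℕ} {M N : Term} {X : List ℕ} : X.Nodup → X.toFinset = fv N →
      RedRule (sub (weak x M) x N) (weaks X M)
  /-- `L` lists triples `(xᵢ, yᵢ, zᵢ)`, where the `xᵢ` enumerate the free variables of `N` and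
  the `yᵢ`, `zᵢ` are distinct fresh variables. The first copy of `N` has each `xᵢ` renamed to
  `yᵢ`, the second one has each `xᵢ` renamed to `zᵢ`. -/
  | D {x y z : ℕ} {M N : Term} {L : List (ℕ × ℕ × ℕ)} :
      (L.map fun t => t.1).Nodup → (L.map fun t => t.1).toFinset = fv N →
      ((L.map fun t => t.2.1) ++ (L.map fun t => t.2.2)).Nodup →
      (∀ u ∈ (L.map fun t => t.2.1) ++ (L.map fun t => t.2.2),
        u ∉ fv M ∧ u ∉ fv N ∧ u ≠ x ∧ u ≠ y ∧ u ≠ z) →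
      RedRule (sub (contr x y z M) x N)
        (contrs L (sub (sub M y (swaps (L.map fun t => (t.1, t.2.1)) N))
          z (swaps (L.map fun t => (t.1, t.2.2)) N)))
  | WAbs {x y : ℕ} {M : Term} : x ≠ y → RedRule (lam x (weak y M)) (weak y (lam x M))
  | WApp1 {y : ℕ} {M N : Term} : RedRule (app (weak y M) N) (weak y (app M N))
  | WApp2 {y : ℕ} {M N : Term} : RedRule (app M (weak y N)) (weak y (app M N))
  | WSubs {x y : ℕ} {M N : Term} : RedRule (sub M x (weak y N)) (weak y (sub M x N))
  /-- The right-hand side is the renaming of `z` by `w` in `M`; `w ∉ fv M` holds whenever the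
  left-hand side is linear. -/
  | Merge {w y z : ℕ} {M : Term} : w ∉ fv M → RedRule (contr w y z (weak y M)) (swap z w M)
  | Cross {w x y z : ℕ} {M : Term} : x ≠ y → x ≠ z →
      RedRule (contr w y z (weak x M)) (weak x (contr w y z M))
  /-- The conditions on `x` are the variable convention. -/
  | CAbs {w x y z : ℕ} {M : Term} : x ≠ w → x ≠ y → x ≠ z →
      RedRule (contr w y z (lam x M)) (lam x (contr w y z M))
  | CApp1 {w y z : ℕ} {M N : Term} : y ∈ fv M → z ∈ fv M →
      RedRule (contr w y z (app M N)) (app (contr w y z M) N)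
  | CApp2 {w y z : ℕ} {M N : Term} : y ∈ fv N → z ∈ fv N →
      RedRule (contr w y z (app M N)) (app M (contr w y z N))
  | CSubs {w x y z : ℕ} {M N : Term} : y ∈ fv N → z ∈ fv N →
      RedRule (contr w y z (sub M x N)) (sub M x (contr w y z N))

/-- Reduction in `λlxr`: the contextual closure of all the reduction rules, modulo `≡`. -/
def Red (M M' : Term) : Prop :=
  ∃ P Q : Term, Equiv M P ∧ Ctxt RedRule P Q ∧ Equiv Q M'

/-- Strong normalisation for the entire reduction relation. -/
def SN (M : Term) : Prop := Acc (fun P Q : Term => Red Q P) M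

end Term

/-! ## Non-idempotent intersection types -/

mutual
/-- `F`-types: atomic types and arrows `A → F`. -/
inductive FTy : Type
  | atom (n : ℕ) : FTy
  | arr (A : ATy) (F : FTy) : FTy
/-- `A`-types: `F`-types and binary intersections. -/
inductive ATy : Type
  | f (F : FTy) : ATy
  | inter (A B : ATy) : ATy
end

/-- `U`-types: `A`-types and the empty type `ω`. -/
inductive UTy : Type
  | a (A : ATy) : UTy
  | omega : UTy

/-- Intersection of `U`-types, with `ω` as neutral element. -/
def UTy.inter : UTy → UTy → UTy
  | .a A, .a B => .a (.inter A B)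
  | .a A, .omega => .a A
  | .omega, U => U

/-- The equivalence `≈` on `A`-types. -/
inductive ATy.Eqv : ATy → ATy → Prop
  | refl (F : FTy) : ATy.Eqv (.f F) (.f F)
  | comm (A B : ATy) : ATy.Eqv (.inter A B) (.inter B A)
  | congr {A A' B B' : ATy} : ATy.Eqv A A' → ATy.Eqv B B' →
      ATy.Eqv (.inter A B) (.inter A' B')
  | trans {A B C : ATy} : ATy.Eqv A B → ATy.Eqv B C → ATy.Eqv A C
  | assoc (A B C : ATy) : ATy.Eqv (.inter (.inter A B) C) (.inter A (.inter B C))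
  | assoc' (A B C : ATy) : ATy.Eqv (.inter A (.inter B C)) (.inter (.inter A B) C)

/-- The equivalence `≈` on `U`-types. -/
inductive UTy.Eqv : UTy → UTy → Prop
  | a {A B : ATy} : ATy.Eqv A B → UTy.Eqv (.a A) (.a B)
  | omega : UTy.Eqv .omega .omega

/-- `U ⊆ V`. -/
def UTy.Sub (U V : UTy) : Prop := ∃ U' : UTy, UTy.Eqv U (UTy.inter V U')

/-- Typing contexts. The contexts of derivable judgements have finite domain, see
`Derives.finite_dom`. -/
abbrev Cx : Type := ℕ → UTy

namespace Cx

/-- The context mapping every variable to `ω`. -/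
def empty : Cx := fun _ => .omega

/-- The context `x : U`. -/
def single (x : ℕ) (U : UTy) : Cx := fun y => if y = x then U else .omega

/-- The intersection `Γ ∩ Δ`, pointwise. -/
def inter (Γ Δ : Cx) : Cx := fun x => UTy.inter (Γ x) (Δ x)

/-- `Γ, x : U`, used only when `Γ x = ω`. -/
def cons (Γ : Cx) (x : ℕ) (U : UTy) : Cx := inter Γ (single x U)

end Cx

/-- The typing system: `Derives Γ M U` is the derivability of `Γ ⊢ M : U`. -/
inductive Derives : Cx → Term → UTy → Prop
  | var (x : ℕ) (F : FTy) : Derives (Cx.single x (.a (.f F))) (.var x) (.a (.f F))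
  | abs {Γ : Cx} {x : ℕ} {M : Term} {A : ATy} {U : UTy} {F : FTy} :
      Γ x = .omega → Derives (Γ.cons x U) M (.a (.f F)) → UTy.Sub (.a A) U →
      Derives Γ (.lam x M) (.a (.f (.arr A F)))
  | app {Γ Δ : Cx} {M N : Term} {A : ATy} {F : FTy} :
      Derives Γ M (.a (.f (.arr A F))) → Derives Δ N (.a A) →
      Derives (Γ.inter Δ) (.app M N) (.a (.f F))
  | inter {Γ Δ : Cx} {M : Term} {A B : ATy} :
      Derives Γ M (.a A) → Derives Δ M (.a B) →
      Derives (Γ.inter Δ) M (.a (.inter A B))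
  | omega (M : Term) : Derives Cx.empty M .omega
  | sub {Γ Δ : Cx} {M N : Term} {x : ℕ} {A : ATy} {U : UTy} {F : FTy} :
      Derives Γ N (.a A) → Δ x = .omega → Derives (Δ.cons x U) M (.a (.f F)) →
      U = .a A ∨ U = .omega →
      Derives (Γ.inter Δ) (.sub M x N) (.a (.f F))
  | contr {Γ : Cx} {x y z : ℕ} {U V₁ V₂ : UTy} {M : Term} {F : FTy} :
      x ≠ y → x ≠ z → y ≠ z → Γ x = .omega → Γ y = .omega → Γ z = .omega →
      Derives (((Γ.cons x U).cons y V₁).cons z V₂) M (.a (.f F)) →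
      Derives (Γ.cons x (UTy.inter U (UTy.inter V₁ V₂))) (.contr x y z M) (.a (.f F))
  | weak {Γ : Cx} {x : ℕ} {U : UTy} {A : ATy} {M : Term} {F : FTy} :
      Γ x = .omega → Derives (Γ.cons x U) M (.a (.f F)) →
      Derives (Γ.cons x (UTy.inter U (.a A))) (.weak x M) (.a (.f F))

theorem UTy.inter_eq_omega {U V : UTy} (h : UTy.inter U V = .omega) :
    U = .omega ∧ V = .omega := by
  cases U <;> cases V <;> simp_all [UTy.inter]

theorem Cx.finite_inter {Γ Δ : Cx} (h : {x | Γ x ≠ .omega}.Finite)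
    (h' : {x | Δ x ≠ .omega}.Finite) : {x | Γ.inter Δ x ≠ .omega}.Finite := by
  refine (h.union h').subset fun x hx => ?_
  by_contra hc
  simp only [Set.mem_union, Set.mem_ofPred_eq, not_or, not_not] at hc
  exact hx (by simp [Cx.inter, hc.1, hc.2, UTy.inter])

theorem Cx.finite_single (x : ℕ) (U : UTy) : {y | Cx.single x U y ≠ .omega}.Finite := by
  refine (Set.finite_singleton x).subset fun y hy => ?_
  by_contra hc
  exact hy (by simp only [Cx.single]; exact if_neg hc)

theorem Cx.finite_of_cons {Γ : Cx} {x : ℕ} {U : UTy}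
    (h : {y | Γ.cons x U y ≠ .omega}.Finite) : {y | Γ y ≠ .omega}.Finite :=
  h.subset fun _ hy hc => hy (UTy.inter_eq_omega hc).1

/-- The context of a derivable judgement has finite domain. -/
theorem Derives.finite_dom {Γ : Cx} {M : Term} {U : UTy} (h : Derives Γ M U) :
    {x | Γ x ≠ .omega}.Finite := by
  induction h with
  | var x F => exact Cx.finite_single _ _
  | abs _ _ _ ih => exact Cx.finite_of_cons ih
  | app _ _ ih₁ ih₂ => exact Cx.finite_inter ih₁ ih₂
  | inter _ _ ih₁ ih₂ => exact Cx.finite_inter ih₁ ih₂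
  | omega M => simp [Cx.empty]
  | sub _ _ _ _ ih₁ ih₂ => exact Cx.finite_inter ih₁ (Cx.finite_of_cons ih₂)
  | contr _ _ _ _ _ _ _ ih =>
    exact Cx.finite_inter (Cx.finite_of_cons (Cx.finite_of_cons (Cx.finite_of_cons ih)))
      (Cx.finite_single _ _)
  | weak _ _ ih => exact Cx.finite_inter (Cx.finite_of_cons ih) (Cx.finite_single _ _)

end Lxr

/-!
Non-idempotent intersection types are quantitative: a derivation types an argument once for each
use that will be made of it, and once if it will be erased. So firing a redex `(λx.M)N` removes an
application from the derivation, while all other rules merely move parts of it around or drop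
some. Hence the number of applications in a derivation bounds the number of such steps, and it
remains to show that the other rules terminate on their own. A linear term is therefore measured
by the lexicographic triple of

* the size `n` of a typing `Ty M n Γ F`,
* the complexity `cplx M`, which counts variable occurrences, those in the body of a substitution
  with the multiplicity `mult` of the substituted variable; it decreases when a substitution
  reaches a variable, a weakening or a contraction, and never increases except in `(λx.M)N`,
* the polynomial interpretation `pol M`, which decreases in all remaining rules.

All three are invariant under the equivalence of terms, `α`-equivalence included (`Equiv.sim`),
and a step of the contextual closure of the rules decreases the triple (`ty_or_of_ctxt`).

The typing system is recast as a predicate `Ty` that is defined by recursion on the term.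
A `U`-type becomes the multiset of its components, which turns `≈` into equality. Since
the free variables of the subterms of a linear term are disjoint, contexts need no splitting
between the premises of a rule; only a `Bag` of derivations, one for each component of an
intersection, splits its context. Contexts are read monotonically, so types that are not used may
stay in them. This makes subject reduction hold for a fixed context, although in the original
system the context may shrink. `Derives.exists_bag` translates derivations into this system. The
cases with some content are those where a substitution or a contraction is pushed into a `Bag`
(`Bag.sub_of_disjoint`, `Bag.contr`) and the duplication of a substituted term, where the bag of
its derivations is split between the two copies (`IsDuplicate.propagates`).
-/

namespace Lxr
open Function

/-! ### Linear terms and renaming -/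

namespace Term

@[simp] theorem linear_var_iff {x : ℕ} : Linear (var x) ↔ True :=
  ⟨fun _ => trivial, fun _ => .var x⟩

@[simp] theorem linear_lam_iff {x : ℕ} {M : Term} :
    Linear (lam x M) ↔ Linear M ∧ x ∈ fv M :=
  ⟨fun h => by cases h; exact ⟨‹_›, ‹_›⟩, fun h => .lam h.1 h.2⟩

@[simp] theorem linear_app_iff {M N : Term} :
    Linear (app M N) ↔ Linear M ∧ Linear N ∧ ∀ u ∈ fv M, u ∉ fv N := by
  rw [← Finset.disjoint_left]
  exact ⟨fun h => by cases h; exact ⟨‹_›, ‹_›, ‹_›⟩, fun h => .app h.1 h.2.1 h.2.2⟩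

@[simp] theorem linear_sub_iff {M N : Term} {x : ℕ} :
    Linear (sub M x N) ↔
      Linear M ∧ Linear N ∧ x ∈ fv M ∧ ∀ u ∈ fv M, u ≠ x → u ∉ fv N := by
  have : (∀ u ∈ fv M, u ≠ x → u ∉ fv N) ↔ Disjoint (fv M \ {x}) (fv N) := by
    simp [Finset.disjoint_left]
  rw [this]
  exact ⟨fun h => by cases h; exact ⟨‹_›, ‹_›, ‹_›, ‹_›⟩,
    fun h => .sub h.1 h.2.1 h.2.2.1 h.2.2.2⟩

@[simp] theorem linear_weak_iff {x : ℕ} {M : Term} :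
    Linear (weak x M) ↔ Linear M ∧ x ∉ fv M :=
  ⟨fun h => by cases h; exact ⟨‹_›, ‹_›⟩, fun h => .weak h.1 h.2⟩

@[simp] theorem linear_contr_iff {x y z : ℕ} {M : Term} :
    Linear (contr x y z M) ↔ Linear M ∧ y ≠ z ∧ y ∈ fv M ∧ z ∈ fv M ∧ x ∉ fv M :=
  ⟨fun h => by cases h; exact ⟨‹_›, ‹_›, ‹_›, ‹_›, ‹_›⟩,
    fun h => .contr h.1 h.2.1 h.2.2.1 h.2.2.2.1 h.2.2.2.2⟩

theorem mem_fv_contr {x y z u : ℕ} {M : Term} (h : y ∈ fv M) :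
    u ∈ fv (contr x y z M) ↔ (u ∈ fv M ∧ u ≠ y ∧ u ≠ z) ∨ u = x := by
  simp [fv, h, or_comm]

theorem mem_fv_perm (π : Equiv.Perm ℕ) (M : Term) (u : ℕ) :
    u ∈ fv (perm π M) ↔ π.symm u ∈ fv M := by
  have key : fv (perm π M) = (fv M).map π.toEmbedding := by
    have hs : ∀ (s : Finset ℕ) (t : Finset ℕ),
        (s \ t).map π.toEmbedding = s.map π.toEmbedding \ t.map π.toEmbedding :=
      fun s t => by ext; simp [Finset.mem_map_equiv]
    induction M with
    | var x => simp [perm, fv]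
    | lam x M ih => simp [perm, fv, ih, hs]
    | app M N ih₁ ih₂ => simp [perm, fv, ih₁, ih₂, Finset.map_union]
    | sub M x N ih₁ ih₂ => simp [perm, fv, ih₁, ih₂, Finset.map_union, hs]
    | weak x M ih => simp [perm, fv, ih]
    | contr x y z M ih =>
      by_cases h : y ∈ fv M ∨ z ∈ fv M <;>
        simp [perm, fv, ih, h, hs]
  rw [key, Finset.mem_map_equiv]

theorem linear_perm (π : Equiv.Perm ℕ) (M : Term) : Linear (perm π M) ↔ Linear M := by
  have hf : ∀ p : ℕ → Prop, (∀ u, p (π.symm u)) ↔ ∀ u, p u := fun p => π.symm.forall_congr_right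
  induction M with
  | var x => simp [perm]
  | lam x M ih => simp [perm, ih, mem_fv_perm]
  | app M N ih₁ ih₂ =>
    simp only [perm, linear_app_iff, ih₁, ih₂, mem_fv_perm]
    rw [hf (fun u => u ∈ fv M → u ∉ fv N)]
  | sub M x N ih₁ ih₂ =>
    simp only [perm, linear_sub_iff, ih₁, ih₂, mem_fv_perm, Equiv.symm_apply_apply]
    rw [← hf (fun u => u ∈ fv M → u ≠ x → u ∉ fv N)]
    simp only [ne_eq, Equiv.symm_apply_eq]
  | weak x M ih => simp [perm, ih, mem_fv_perm]
  | contr x y z M ih => simp [perm, ih, mem_fv_perm]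

/-! ### Multiplicities and the measures of propagation -/

/-- The multiplicity of a free variable of a linear term: a bound on the number of copies that
will be made of a term substituted for it. The summand `1` in the case of a contraction makes
`cplx` decrease when a term is duplicated; the one in the case of a substitution keeps
multiplicities from increasing when a contraction is moved into its body `N`. On the other variables
the multiplicity is `0`, which is why `u ∈ fv N` is tested. -/
def mult : Term → ℕ → ℕ
  | var y => fun u => if u = y then 1 else 0
  | lam y M => fun u => if u = y then 0 else mult M u
  | app M N => fun u => mult M u + mult N u
  | sub M y N => fun u =>
      (if u = y then 0 else mult M u) + if u ∈ fv N then mult M y * (mult N u + 1) else 0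
  | weak y M => fun u => if u = y then 1 else mult M u
  | contr x y z M => fun u =>
      if u = x then mult M y + mult M z + 1 else if u = y ∨ u = z then 0 else mult M u

/-- The number of variable occurrences of a term, where those in the body of a substitution are
counted with the multiplicity of the variable it is substituted for. -/
def cplx : Term → ℕ
  | var _ => 1
  | lam _ M => cplx M
  | app M N => cplx M + cplx N
  | sub M x N => cplx M + mult M x * cplx N
  | weak _ M => cplx M
  | contr _ _ _ M => cplx M

/-- A polynomial interpretation that decreases when substitutions and contractions are pushed
inwards and weakenings are pulled outwards. -/
def pol : Term → ℕ
  | var _ => 2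
  | lam _ M => 2 * pol M + 2
  | app M N => 2 * (pol M + pol N) + 2
  | sub M _ N => pol M * (pol N + 1)
  | weak _ M => pol M + 1
  | contr _ _ _ M => 2 * pol M

theorem mult_perm (π : Equiv.Perm ℕ) (M : Term) (u : ℕ) :
    mult (perm π M) u = mult M (π.symm u) := by
  induction M generalizing u with
  | var x => simp [perm, mult, Equiv.symm_apply_eq]
  | lam x M ih => simp [perm, mult, ih, Equiv.symm_apply_eq]
  | app M N ih₁ ih₂ => simp [perm, mult, ih₁, ih₂]
  | sub M x N ih₁ ih₂ => simp [perm, mult, ih₁, ih₂, Equiv.symm_apply_eq, mem_fv_perm]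
  | weak x M ih => simp [perm, mult, ih, Equiv.symm_apply_eq]
  | contr x y z M ih => simp [perm, mult, ih, Equiv.symm_apply_eq]

@[simp] theorem cplx_perm (π : Equiv.Perm ℕ) (M : Term) : cplx (perm π M) = cplx M := by
  induction M <;> simp_all [perm, cplx, mult_perm]

@[simp] theorem pol_perm (π : Equiv.Perm ℕ) (M : Term) : pol (perm π M) = pol M := by
  induction M <;> simp_all [perm, pol]

theorem one_le_cplx (M : Term) : 1 ≤ cplx M := by
  induction M <;> simp only [cplx] <;> omega

theorem two_le_pol (M : Term) : 2 ≤ pol M := by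
  induction M with
  | sub M x N ih₁ ih₂ => simp only [pol]; nlinarith
  | _ => simp only [pol]; omega

theorem Linear.mult_eq_zero {M : Term} (h : Linear M) {u : ℕ} (hu : u ∉ fv M) :
    mult M u = 0 := by
  induction h with
  | var x => simpa [mult, fv] using hu
  | app _ _ _ ih₁ ih₂ => simp_all [mult, fv]
  | lam _ _ ih => simp only [mult]; split_ifs <;> simp_all [fv]
  | sub _ _ _ _ ih₁ ih₂ => simp only [mult]; split_ifs <;> simp_all [fv]
  | weak _ _ ih => simp only [mult]; split_ifs <;> simp_all [fv]
  | contr _ _ hy hz _ ih =>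
    rw [mem_fv_contr hy] at hu
    simp only [mult]; grind

theorem Linear.mult_pos {M : Term} (h : Linear M) {u : ℕ} (hu : u ∈ fv M) :
    1 ≤ mult M u := by
  induction h generalizing u with
  | var x => simp_all [mult, fv]
  | app _ _ _ ih₁ ih₂ =>
    simp only [fv, Finset.mem_union] at hu
    simp only [mult]; rcases hu with hu | hu
    · have := ih₁ hu; omega
    · have := ih₂ hu; omega
  | lam _ _ ih => simp only [mult]; split_ifs <;> simp_all [fv]
  | sub _ _ hx _ ih₁ ih₂ =>
    simp only [fv, Finset.mem_union, Finset.mem_sdiff, Finset.mem_singleton] at hu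
    simp only [mult]
    by_cases hN : u ∈ fv ‹_›
    · have := ih₁ hx
      rw [if_pos hN]; exact le_add_left (Nat.mul_pos this (Nat.succ_pos _))
    · have := ih₁ (hu.resolve_right hN).1
      rw [if_neg (hu.resolve_right hN).2]; omega
  | weak _ _ ih => simp only [mult]; split_ifs <;> simp_all [fv]
  | contr _ _ hy hz _ ih =>
    rw [mem_fv_contr hy] at hu
    simp only [mult]; grind

end Term

/-! ### Multiset types -/

/-- The multiset of the `F`-types of which an `A`-type is the intersection. -/
def ATy.ms : ATy → Multiset FTy
  | .f F => {F}
  | .inter A B => A.ms + B.ms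

/-- The multiset of the `F`-types of which a `U`-type is the intersection. -/
def UTy.ms : UTy → Multiset FTy
  | .a A => A.ms
  | .omega => 0

/-- Contexts assigning multisets of `F`-types. -/
abbrev MCx : Type := ℕ → Multiset FTy

/-- The context of multisets underlying a typing context. -/
def Cx.ms (Γ : Cx) : MCx := fun x => (Γ x).ms

theorem ATy.ms_ne_zero : ∀ A : ATy, A.ms ≠ 0
  | .f F => Multiset.singleton_ne_zero F
  | .inter A B => by simp [ATy.ms, A.ms_ne_zero]

theorem ATy.Eqv.ms_eq {A B : ATy} (h : ATy.Eqv A B) : A.ms = B.ms := by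
  induction h <;> simp_all [ATy.ms, add_comm, add_assoc]

@[simp] theorem UTy.ms_inter (U V : UTy) : (UTy.inter U V).ms = U.ms + V.ms := by
  cases U <;> cases V <;> simp [UTy.inter, UTy.ms, ATy.ms]

theorem UTy.Sub.ms_le {U V : UTy} (h : UTy.Sub U V) : V.ms ≤ U.ms := by
  obtain ⟨W, h⟩ := h
  have : U.ms = (UTy.inter V W).ms := by
    generalize UTy.inter V W = V' at h
    cases h with
    | a h => exact h.ms_eq
    | omega => rfl
  simp [this]

/-- `Bag P n Γ S`: the types in the multiset `S` are derivable, in the sense of `P`, with sizes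
adding up to at most `n` and contexts adding up to at most `Γ`. -/
inductive Bag (P : ℕ → MCx → FTy → Prop) : ℕ → MCx → Multiset FTy → Prop
  | nil (n : ℕ) (Γ : MCx) : Bag P n Γ 0
  | cons {n a b : ℕ} {Γ Δ Θ : MCx} {F : FTy} {S : Multiset FTy} :
      P a Δ F → Bag P b Θ S → a + b ≤ n → Δ + Θ ≤ Γ → Bag P n Γ (F ::ₘ S)

/-- `P` is monotone in the size and in the values of the context on `s`, and does not depend on
its other values. -/
def LocalOn (s : Finset ℕ) (P : ℕ → MCx → FTy → Prop) : Prop :=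
  ∀ ⦃n n' : ℕ⦄ ⦃Γ Γ' : MCx⦄ ⦃F : FTy⦄, P n Γ F → n ≤ n' → (∀ x ∈ s, Γ x ≤ Γ' x) → P n' Γ' F

namespace Bag

variable {P Q : ℕ → MCx → FTy → Prop} {n n' : ℕ} {Γ Γ' : MCx} {S T : Multiset FTy} {F : FTy}

theorem single (h : P n Γ F) : Bag P n Γ {F} :=
  .cons h (.nil 0 0) (by simp) (by simp)

theorem mono (h : Bag P n Γ S) (hn : n ≤ n') (hΓ : Γ ≤ Γ') : Bag P n' Γ' S := by
  cases h with
  | nil => exact .nil _ _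
  | cons h₁ h₂ h₃ h₄ => exact .cons h₁ h₂ (h₃.trans hn) (h₄.trans hΓ)

theorem local_mono {s : Finset ℕ} (hP : LocalOn s P) (h : Bag P n Γ S) (hn : n ≤ n')
    (hΓ : ∀ x ∈ s, Γ x ≤ Γ' x) : Bag P n' Γ' S := by
  induction h generalizing n' Γ' with
  | nil => exact .nil _ _
  | @cons n a b Γ Δ Θ F S h₁ h₂ h₃ h₄ ih =>
    refine .cons (Δ := fun x => if x ∈ s then Δ x else 0)
      (Θ := fun x => if x ∈ s then Θ x else 0)
      (hP h₁ le_rfl fun x hx => ?_) (ih le_rfl fun x hx => ?_) (h₃.trans hn) fun x => ?_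
    · simp [hx]
    · simp [hx]
    · by_cases hx : x ∈ s
      · simpa [hx] using (h₄ x).trans (hΓ x hx)
      · simp [hx]

/-- A bag of derivations of an intersection splits. -/
theorem split (h : Bag P n Γ S) : ∀ {S₁ S₂ : Multiset FTy}, S₁ + S₂ ≤ S →
    ∃ n₁ n₂ Γ₁ Γ₂, n₁ + n₂ ≤ n ∧ Γ₁ + Γ₂ ≤ Γ ∧ Bag P n₁ Γ₁ S₁ ∧ Bag P n₂ Γ₂ S₂ := by
  induction h with
  | nil n Γ =>
    intro S₁ S₂ hS
    have h0 : S₁ + S₂ = 0 := Multiset.le_zero.1 hS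
    rw [add_eq_zero] at h0
    obtain ⟨rfl, rfl⟩ := h0
    exact ⟨0, 0, 0, 0, by simp, by simp, .nil _ _, .nil _ _⟩
  | @cons n a b Γ Δ Θ F S h₁ h₂ h₃ h₄ ih =>
    intro S₁ S₂ hS
    by_cases hF₁ : F ∈ S₁
    · obtain ⟨S₁, rfl⟩ := Multiset.exists_cons_of_mem hF₁
      rw [Multiset.cons_add, Multiset.cons_le_cons_iff] at hS
      obtain ⟨n₁, n₂, Γ₁, Γ₂, hn, hΓ, hb₁, hb₂⟩ := ih hS
      exact ⟨a + n₁, n₂, Δ + Γ₁, Γ₂, by omega,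
        by rw [add_assoc]; exact (add_le_add_right hΓ Δ).trans h₄,
        .cons h₁ hb₁ le_rfl le_rfl, hb₂⟩
    by_cases hF₂ : F ∈ S₂
    · obtain ⟨S₂, rfl⟩ := Multiset.exists_cons_of_mem hF₂
      rw [Multiset.add_cons, Multiset.cons_le_cons_iff] at hS
      obtain ⟨n₁, n₂, Γ₁, Γ₂, hn, hΓ, hb₁, hb₂⟩ := ih hS
      exact ⟨n₁, a + n₂, Γ₁, Δ + Γ₂, by omega,
        by rw [add_left_comm]; exact (add_le_add_right hΓ Δ).trans h₄,
        hb₁, .cons h₁ hb₂ le_rfl le_rfl⟩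
    · rw [Multiset.le_cons_of_notMem (by simp [hF₁, hF₂])] at hS
      obtain ⟨n₁, n₂, Γ₁, Γ₂, hn, hΓ, hb⟩ := ih hS
      exact ⟨n₁, n₂, Γ₁, Γ₂, by omega,
        hΓ.trans ((le_add_of_nonneg_left (zero_le : 0 ≤ Δ)).trans h₄), hb⟩

theorem le (h : Bag P n Γ S) (hT : T ≤ S) : Bag P n Γ T := by
  obtain ⟨n₁, n₂, Γ₁, Γ₂, hn, hΓ, h₁, -⟩ := h.split (S₁ := T) (S₂ := 0) (by simpa using hT)
  exact h₁.mono (by omega) ((le_add_of_nonneg_right (zero_le : 0 ≤ Γ₂)).trans hΓ)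

theorem add {m : ℕ} {Δ : MCx} (h₁ : Bag P n Γ S) (h₂ : Bag P m Δ T) :
    Bag P (n + m) (Γ + Δ) (S + T) := by
  induction h₁ with
  | nil n Γ => rw [zero_add]; exact h₂.mono (by omega) (le_add_of_nonneg_left zero_le)
  | cons h h' hn hΓ ih =>
    rw [Multiset.cons_add]
    exact .cons h ih (by omega) (by rw [← add_assoc]; exact add_le_add_left hΓ Δ)

theorem exists_of_mem (h : Bag P n Γ S) (hF : F ∈ S) :
    ∃ m Δ, m ≤ n ∧ Δ ≤ Γ ∧ P m Δ F := by
  induction h with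
  | nil => simp at hF
  | @cons n a b Γ Δ Θ G S h₁ _ hn hΓ ih =>
    rcases Multiset.mem_cons.1 hF with rfl | hF
    · exact ⟨a, Δ, by omega, (le_add_of_nonneg_right (zero_le : 0 ≤ Θ)).trans hΓ, h₁⟩
    · obtain ⟨m, Δ', hm, hΔ', h⟩ := ih hF
      exact ⟨m, Δ', by omega, hΔ'.trans ((le_add_of_nonneg_left (zero_le : 0 ≤ Δ)).trans hΓ), h⟩

theorem apply_ne_zero (h : Bag P n Γ S) (hS : S ≠ 0) {u : ℕ}
    (H : ∀ n Γ F, P n Γ F → Γ u ≠ 0) : Γ u ≠ 0 := by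
  obtain ⟨F, hF⟩ := Multiset.exists_mem_of_ne_zero hS
  obtain ⟨m, Δ, -, hΔ, h⟩ := h.exists_of_mem hF
  exact fun h0 => H _ _ _ h (Multiset.le_zero.1 (h0 ▸ hΔ u))

theorem map {φ : MCx → MCx} (hφ : ∀ Δ Θ Γ, Δ + Θ ≤ Γ → φ Δ + φ Θ ≤ φ Γ)
    (H : ∀ n Γ F, P n Γ F → Q n (φ Γ) F) (h : Bag P n Γ S) : Bag Q n (φ Γ) S := by
  induction h with
  | nil => exact .nil _ _
  | cons h₁ _ h₃ h₄ ih => exact .cons (H _ _ _ h₁) ih h₃ (hφ _ _ _ h₄)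

theorem imp (h : Bag P n Γ S) (H : ∀ n Γ F, P n Γ F → Q n Γ F) : Bag Q n Γ S :=
  h.map (φ := id) (fun _ _ _ h => h) H

/-- If every derivation can be made smaller, so can a non-empty bag of them. -/
theorem imp_lt (h : Bag P n Γ S) (hS : S ≠ 0)
    (H : ∀ n Γ F, P n Γ F → ∃ m < n, Q m Γ F) : ∃ m < n, Bag Q m Γ S := by
  cases h with
  | nil => exact absurd rfl hS
  | @cons _ a b _ Δ Θ F S h₁ h₂ h₃ h₄ =>
    obtain ⟨m, hm, h⟩ := H _ _ _ h₁
    have h₅ : Bag Q b Θ S := by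
      clear hS h₁ h₃ h₄ h hm
      induction h₂ with
      | nil => exact .nil _ _
      | cons h₁ _ h₃ h₄ ih =>
        obtain ⟨m, hm, h⟩ := H _ _ _ h₁
        exact .cons h ih (by omega) h₄
    exact ⟨m + b, by omega, .cons h h₅ le_rfl h₄⟩

end Bag

/-! ### Sized typing with shared contexts -/

/-- `Ty M n Γ F`: the term `M` has type `F` in the context `Γ`, with at most `n` applications in
the derivation. Since the free variables of the subterms of a linear term are disjoint, the
premises of a rule share the context `Γ` instead of splitting it, and only the derivations of the
components of an intersection split it. An argument, or the body of a substitution, is typed at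
least once, so that a redex in it shows in the size, even if it will be erased. The types of
a context need not be used, which makes the inclusion of types in the typing rule for abstractions
superfluous. -/
def Ty : Term → ℕ → MCx → FTy → Prop
  | .var x => fun _ Γ F => F ∈ Γ x
  | .lam x M => fun n Γ G => ∃ A F, G = .arr A F ∧ Ty M n (update Γ x A.ms) F
  | .app M N => fun n Γ F =>
      ∃ A a b, a + b + 1 ≤ n ∧ Ty M a Γ (.arr A F) ∧ Bag (Ty N) b Γ A.ms
  | .sub M x N => fun n Γ F =>
      ∃ S a b, a + b ≤ n ∧ S ≠ 0 ∧ Ty M a (update Γ x S) F ∧ Bag (Ty N) b Γ S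
  | .weak x M => fun n Γ F => Γ x ≠ 0 ∧ Ty M n Γ F
  | .contr x y z M => fun n Γ F =>
      ∃ S T, S + T ≤ Γ x ∧ Ty M n (update (update Γ y S) z T) F

theorem update_le_update {Γ Δ : MCx} {x u : ℕ} (S : Multiset FTy) (h : u ≠ x → Γ u ≤ Δ u) :
    update Γ x S u ≤ update Δ x S u := by
  by_cases hu : u = x
  · subst hu; simp
  · simpa [hu] using h hu

theorem Ty.localOn (M : Term) : LocalOn M.fv (Ty M) := by
  induction M with
  | var x => exact fun n n' Γ Γ' F h _ hΓ => Multiset.mem_of_le (hΓ x (by simp [Term.fv])) h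
  | lam x M ih =>
    rintro n n' Γ Γ' G ⟨A, F, rfl, h⟩ hn hΓ
    exact ⟨A, F, rfl, ih h hn fun u hu => update_le_update _ fun hx =>
      hΓ u (by simp [Term.fv, hu, hx])⟩
  | app M N ih₁ ih₂ =>
    rintro n n' Γ Γ' F ⟨A, a, b, hab, h₁, h₂⟩ hn hΓ
    exact ⟨A, a, b, hab.trans hn, ih₁ h₁ le_rfl fun u hu => hΓ u (by simp [Term.fv, hu]),
      h₂.local_mono ih₂ le_rfl fun u hu => hΓ u (by simp [Term.fv, hu])⟩
  | sub M x N ih₁ ih₂ =>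
    rintro n n' Γ Γ' F ⟨S, a, b, hab, hS, h₁, h₂⟩ hn hΓ
    exact ⟨S, a, b, hab.trans hn, hS,
      ih₁ h₁ le_rfl fun u hu => update_le_update _ fun hx => hΓ u (by simp [Term.fv, hu, hx]),
      h₂.local_mono ih₂ le_rfl fun u hu => hΓ u (by simp [Term.fv, hu])⟩
  | weak x M ih =>
    rintro n n' Γ Γ' F ⟨hx, h⟩ hn hΓ
    exact ⟨fun h0 => hx (Multiset.le_zero.1 (h0 ▸ hΓ x (by simp [Term.fv]))),
      ih h hn fun u hu => hΓ u (by simp [Term.fv, hu])⟩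
  | contr x y z M ih =>
    rintro n n' Γ Γ' F ⟨S, T, hST, h⟩ hn hΓ
    by_cases hyz : y ∈ M.fv ∨ z ∈ M.fv
    · exact ⟨S, T, hST.trans (hΓ x (by simp [Term.fv, hyz])),
        ih h hn fun u hu => update_le_update _ fun hz => update_le_update _ fun hy =>
          hΓ u (by simp [Term.fv, hyz, hu, hy, hz])⟩
    · refine ⟨0, 0, by simp, ih h hn fun u hu => ?_⟩
      rw [not_or] at hyz
      have hy : u ≠ y := ne_of_mem_of_not_mem hu hyz.1
      have hz : u ≠ z := ne_of_mem_of_not_mem hu hyz.2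
      simpa [hy, hz] using hΓ u (by simp [Term.fv, hyz, hu])

theorem Ty.congr {M : Term} {n n' : ℕ} {Γ Γ' : MCx} {F : FTy} (h : Ty M n Γ F) (hn : n ≤ n')
    (hΓ : ∀ u ∈ M.fv, Γ u ≤ Γ' u) : Ty M n' Γ' F :=
  Ty.localOn M h hn hΓ

theorem Bag.congr {M : Term} {n n' : ℕ} {Γ Γ' : MCx} {S : Multiset FTy} (h : Bag (Ty M) n Γ S)
    (hn : n ≤ n') (hΓ : ∀ u ∈ M.fv, Γ u ≤ Γ' u) : Bag (Ty M) n' Γ' S :=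
  h.local_mono (Ty.localOn M) hn hΓ

theorem Bag.update_iff {M : Term} {n : ℕ} {Γ : MCx} {S T : Multiset FTy} {x : ℕ}
    (hx : x ∉ M.fv) : Bag (Ty M) n (update Γ x T) S ↔ Bag (Ty M) n Γ S := by
  constructor <;> refine fun h => h.congr le_rfl fun u hu => ?_ <;>
    rw [update_of_ne (ne_of_mem_of_not_mem hu hx)]

/-- The free variables of a linear term are used by each of its derivations. -/
theorem Ty.ne_zero {M : Term} (hM : M.Linear) {n : ℕ} {Γ : MCx} {F : FTy} (h : Ty M n Γ F)
    {u : ℕ} (hu : u ∈ M.fv) : Γ u ≠ 0 := by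
  induction hM generalizing n Γ F u with
  | var x =>
    obtain rfl : u = x := by simpa [Term.fv] using hu
    exact fun h0 => by simp [Ty, h0] at h
  | app _ _ _ ih₁ ih₂ =>
    obtain ⟨A, a, b, hab, h₁, h₂⟩ := h
    rcases Finset.mem_union.1 hu with hu | hu
    · exact ih₁ h₁ hu
    · exact h₂.apply_ne_zero A.ms_ne_zero fun _ _ _ h => ih₂ h hu
  | lam _ _ ih =>
    obtain ⟨A, F, rfl, h⟩ := h
    simp only [Term.fv, Finset.mem_sdiff, Finset.mem_singleton] at hu
    simpa [hu.2] using ih h hu.1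
  | sub _ _ _ _ ih₁ ih₂ =>
    obtain ⟨S, a, b, hab, hS, h₁, h₂⟩ := h
    rcases Finset.mem_union.1 hu with hu | hu
    · simp only [Finset.mem_sdiff, Finset.mem_singleton] at hu
      simpa [hu.2] using ih₁ h₁ hu.1
    · exact h₂.apply_ne_zero hS fun _ _ _ h => ih₂ h hu
  | weak _ _ ih =>
    simp only [Term.fv, Finset.mem_union, Finset.mem_singleton] at hu
    rcases hu with hu | rfl
    · exact ih h.2 hu
    · exact h.1
  | contr _ _ hy hz _ ih =>
    obtain ⟨S, T, hST, h⟩ := h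
    rcases (Term.mem_fv_contr hy).1 hu with hu | rfl
    · simpa [hu.2.1, hu.2.2] using ih h hu.1
    · intro h0
      rw [h0, Multiset.le_zero] at hST
      exact ih h hz (by simp [(add_eq_zero.1 hST).2])

/-! ### Renaming in typings -/

theorem Bag.perm {P Q : ℕ → MCx → FTy → Prop} {f : ℕ → ℕ}
    (h : ∀ n Γ F, P n Γ F → Q n (Γ ∘ f) F) {n : ℕ} {Γ : MCx} {S : Multiset FTy}
    (hb : Bag P n Γ S) : Bag Q n (Γ ∘ f) S :=
  hb.map (φ := fun Γ => Γ ∘ f) (fun _ _ _ h x => h (f x)) h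

theorem Ty.perm {M : Term} (π : Equiv.Perm ℕ) {n : ℕ} {Γ : MCx} {F : FTy} (h : Ty M n Γ F) :
    Ty (M.perm π) n (Γ ∘ π.symm) F := by
  have hup : ∀ (Γ : MCx) (x : ℕ) (S : Multiset FTy),
      update Γ x S ∘ π.symm = update (Γ ∘ π.symm) (π x) S := by
    intro Γ x S
    funext u
    simp [update_apply, Equiv.symm_apply_eq]
  induction M generalizing n Γ F with
  | var x => simpa [Ty, Term.perm] using h
  | lam x M ih =>
    obtain ⟨A, F, rfl, h⟩ := h
    exact ⟨A, F, rfl, hup _ _ _ ▸ ih h⟩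
  | app M N ih₁ ih₂ =>
    obtain ⟨A, a, b, hab, h₁, h₂⟩ := h
    exact ⟨A, a, b, hab, ih₁ h₁, h₂.perm fun _ _ _ h => ih₂ h⟩
  | sub M x N ih₁ ih₂ =>
    obtain ⟨S, a, b, hab, hS, h₁, h₂⟩ := h
    exact ⟨S, a, b, hab, hS, hup _ _ _ ▸ ih₁ h₁, h₂.perm fun _ _ _ h => ih₂ h⟩
  | weak x M ih => exact ⟨by simpa using h.1, ih h.2⟩
  | contr x y z M ih =>
    obtain ⟨S, T, hST, h⟩ := h
    exact ⟨S, T, by simpa using hST, by simpa only [hup] using ih h⟩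

theorem Term.perm_symm_perm (π : Equiv.Perm ℕ) (M : Term) : (M.perm π).perm π.symm = M := by
  induction M <;> simp_all [Term.perm]

theorem Ty.perm_iff {M : Term} {π : Equiv.Perm ℕ} {n : ℕ} {Γ : MCx} {F : FTy} :
    Ty (M.perm π) n Γ F ↔ Ty M n (Γ ∘ π) F := by
  constructor
  · intro h
    simpa [Term.perm_symm_perm] using h.perm π.symm
  · intro h
    simpa [comp_assoc] using h.perm π

theorem Bag.perm_iff {M : Term} {π : Equiv.Perm ℕ} {n : ℕ} {Γ : MCx} {S : Multiset FTy} :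
    Bag (Ty (M.perm π)) n Γ S ↔ Bag (Ty M) n (Γ ∘ π) S := by
  constructor
  · intro h
    exact h.perm fun n Γ F h => Ty.perm_iff.1 h
  · intro h
    have := h.perm (Q := Ty (M.perm π)) (f := π.symm) fun n Γ F h => h.perm π
    simpa [comp_assoc] using this

/-! ### Typable terms have sized typings -/

/-- Derivations in the given system yield sized typings; the context and the types are read as
multisets. -/
theorem Derives.exists_bag {Γ : Cx} {M : Term} {U : UTy} (h : Derives Γ M U) :
    ∃ n, Bag (Ty M) n Γ.ms U.ms := by
  have hle : ∀ Γ Δ : Cx, Γ.ms ≤ (Γ.inter Δ).ms ∧ Δ.ms ≤ (Γ.inter Δ).ms := by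
    intro Γ Δ
    constructor <;> intro u <;> simp [Cx.ms, Cx.inter]
  have hsingle : ∀ {M : Term} {n : ℕ} {Γ : MCx} {F : FTy},
      Bag (Ty M) n Γ (UTy.a (.f F)).ms → Ty M n Γ F := by
    intro M n Γ F h
    obtain ⟨m, Δ, hm, hΔ, h⟩ := h.exists_of_mem (F := F) (by simp [UTy.ms, ATy.ms])
    exact h.congr hm fun u _ => hΔ u
  have hcons : ∀ (Γ : Cx) (x : ℕ) (U : UTy) (u : ℕ),
      (Γ.cons x U).ms u = Γ.ms u + if u = x then U.ms else 0 := by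
    intro Γ x U u
    simp only [Cx.ms, Cx.cons, Cx.inter, Cx.single, UTy.ms_inter]
    split_ifs <;> rfl
  induction h with
  | var x F => exact ⟨0, .single (by simp [Ty, Cx.ms, Cx.single, UTy.ms, ATy.ms])⟩
  | @abs Γ x M A U F hx _ hU ih =>
    obtain ⟨n, h⟩ := ih
    refine ⟨n, .single ⟨A, F, rfl, (hsingle h).congr le_rfl fun u _ => ?_⟩⟩
    rw [hcons]
    by_cases hu : u = x
    · subst hu
      simpa [Cx.ms, hx, UTy.ms] using hU.ms_le
    · simp [hu]
  | @app Γ Δ M N A F _ _ ih₁ ih₂ =>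
    obtain ⟨a, h₁⟩ := ih₁
    obtain ⟨b, h₂⟩ := ih₂
    exact ⟨a + b + 1, .single ⟨A, a, b, le_rfl, (hsingle h₁).congr le_rfl fun u _ => (hle Γ Δ).1 u,
      h₂.mono le_rfl (hle Γ Δ).2⟩⟩
  | @inter Γ Δ M A B _ _ ih₁ ih₂ =>
    obtain ⟨a, h₁⟩ := ih₁
    obtain ⟨b, h₂⟩ := ih₂
    refine ⟨a + b, (h₁.add h₂).mono le_rfl fun u => ?_⟩
    simp [Cx.ms, Cx.inter]
  | omega M => exact ⟨0, .nil _ _⟩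
  | @sub Γ Δ M N x A U F _ hx _ hU ih₁ ih₂ =>
    obtain ⟨b, h₁⟩ := ih₁
    obtain ⟨a, h₂⟩ := ih₂
    refine ⟨a + b, .single ⟨A.ms, a, b, le_rfl, A.ms_ne_zero,
      (hsingle h₂).congr le_rfl fun u _ => ?_, h₁.mono le_rfl (hle Γ Δ).1⟩⟩
    rw [hcons]
    by_cases hu : u = x
    · subst hu
      rcases hU with rfl | rfl <;> simp [Cx.ms, hx, UTy.ms]
    · simpa [hu] using (hle Γ Δ).2 u
  | @contr Γ x y z U V₁ V₂ M F hxy hxz hyz hx hy hz _ ih =>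
    obtain ⟨n, h⟩ := ih
    refine ⟨n, .single ⟨V₁.ms, V₂.ms, by simp [hcons, ← add_assoc],
      (hsingle h).congr le_rfl fun u _ => ?_⟩⟩
    simp only [hcons, update_apply]
    have hy' : Γ.ms y = 0 := by simp [Cx.ms, hy, UTy.ms]
    have hz' : Γ.ms z = 0 := by simp [Cx.ms, hz, UTy.ms]
    by_cases huz : u = z
    · subst huz; simp [hz', hxz.symm, hyz.symm]
    by_cases huy : u = y
    · subst huy; simp [hy', hxy.symm, hyz]
    by_cases hux : u = x
    · subst hux; simp [huy, huz]
    · simp [hux, huy, huz]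
  | @weak Γ x U A M F hx _ ih =>
    obtain ⟨n, h⟩ := ih
    refine ⟨n, .single ⟨?_, (hsingle h).congr le_rfl fun u _ => ?_⟩⟩
    · rw [hcons]
      simp only [UTy.ms_inter]
      simp [UTy.ms, A.ms_ne_zero]
    · simp only [hcons]
      by_cases hu : u = x <;> simp [hu]

/-! ### Invariance under the equivalence of terms -/

namespace Term

/-- Two terms that agree in all that the termination proof observes. -/
structure Same (M M' : Term) : Prop where
  fv : fv M = fv M'
  mult : mult M = mult M'
  cplx : cplx M = cplx M'
  pol : pol M = pol M'
  ty : Ty M = Ty M'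

/-- Two terms that are both linear, and then agree in all that the termination proof observes, or
both not linear. -/
def Sim (M M' : Term) : Prop := (Linear M ↔ Linear M') ∧ (Linear M → Same M M')

theorem Sim.refl (M : Term) : Sim M M := ⟨Iff.rfl, fun _ => ⟨rfl, rfl, rfl, rfl, rfl⟩⟩

theorem Sim.symm {M M' : Term} (h : Sim M M') : Sim M' M :=
  ⟨h.1.symm, fun hM =>
    have := h.2 (h.1.2 hM)
    ⟨this.fv.symm, this.mult.symm, this.cplx.symm, this.pol.symm, this.ty.symm⟩⟩

theorem Sim.trans {M M' M'' : Term} (h : Sim M M') (h' : Sim M' M'') : Sim M M'' :=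
  ⟨h.1.trans h'.1, fun hM =>
    have h₁ := h.2 hM
    have h₂ := h'.2 (h.1.1 hM)
    ⟨h₁.fv.trans h₂.fv, h₁.mult.trans h₂.mult, h₁.cplx.trans h₂.cplx, h₁.pol.trans h₂.pol,
      h₁.ty.trans h₂.ty⟩⟩

theorem Sim.of_ctxt {R : Term → Term → Prop} (hR : ∀ M M', R M M' → Sim M M') {M M' : Term}
    (h : Ctxt R M M') : Sim M M' := by
  induction h with
  | base h => exact hR _ _ h
  | lam x _ ih =>
    refine ⟨?_, fun h => ?_⟩
    · simp only [linear_lam_iff, ← ih.1]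
      exact and_congr_right fun h => by rw [(ih.2 h).fv]
    · obtain ⟨h₁, h₂, h₃, h₄, h₅⟩ := ih.2 (linear_lam_iff.1 h).1
      constructor <;> simp only [Term.fv, Term.mult, Term.cplx, Term.pol, Ty, *]
  | appL N _ ih =>
    refine ⟨?_, fun h => ?_⟩
    · simp only [linear_app_iff, ← ih.1]
      exact and_congr_right fun h => by rw [(ih.2 h).fv]
    · obtain ⟨h₁, h₂, h₃, h₄, h₅⟩ := ih.2 (linear_app_iff.1 h).1
      constructor <;> simp only [Term.fv, Term.mult, Term.cplx, Term.pol, Ty, *]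
  | appR N _ ih =>
    refine ⟨?_, fun h => ?_⟩
    · simp only [linear_app_iff, ← ih.1]
      exact and_congr_right fun _ => and_congr_right fun h => by rw [(ih.2 h).fv]
    · obtain ⟨h₁, h₂, h₃, h₄, h₅⟩ := ih.2 (linear_app_iff.1 h).2.1
      constructor <;> simp only [Term.fv, Term.mult, Term.cplx, Term.pol, Ty, *]
  | subL x N _ ih =>
    refine ⟨?_, fun h => ?_⟩
    · simp only [linear_sub_iff, ← ih.1]
      exact and_congr_right fun h => by rw [(ih.2 h).fv]
    · obtain ⟨h₁, h₂, h₃, h₄, h₅⟩ := ih.2 (linear_sub_iff.1 h).1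
      constructor <;> simp only [Term.fv, Term.mult, Term.cplx, Term.pol, Ty, *]
  | subR M x _ ih =>
    refine ⟨?_, fun h => ?_⟩
    · simp only [linear_sub_iff, ← ih.1]
      exact and_congr_right fun _ => and_congr_right fun h => by rw [(ih.2 h).fv]
    · obtain ⟨h₁, h₂, h₃, h₄, h₅⟩ := ih.2 (linear_sub_iff.1 h).2.1
      constructor <;> simp only [Term.fv, Term.mult, Term.cplx, Term.pol, Ty, *]
  | weak x _ ih =>
    refine ⟨?_, fun h => ?_⟩
    · simp only [linear_weak_iff, ← ih.1]
      exact and_congr_right fun h => by rw [(ih.2 h).fv]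
    · obtain ⟨h₁, h₂, h₃, h₄, h₅⟩ := ih.2 (linear_weak_iff.1 h).1
      constructor <;> simp only [Term.fv, Term.mult, Term.cplx, Term.pol, Ty, *]
  | contr x y z _ ih =>
    refine ⟨?_, fun h => ?_⟩
    · simp only [linear_contr_iff, ← ih.1]
      exact and_congr_right fun h => by rw [(ih.2 h).fv]
    · obtain ⟨h₁, h₂, h₃, h₄, h₅⟩ := ih.2 (linear_contr_iff.1 h).1
      constructor <;> simp only [Term.fv, Term.mult, Term.cplx, Term.pol, Ty, *]

theorem mem_fv_swap {a b u : ℕ} {M : Term} :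
    u ∈ fv (swap a b M) ↔ Equiv.swap a b u ∈ fv M := by
  rw [swap, mem_fv_perm, Equiv.symm_swap]

theorem mult_swap {a b u : ℕ} {M : Term} : mult (swap a b M) u = mult M (Equiv.swap a b u) := by
  rw [swap, mult_perm, Equiv.symm_swap]

theorem linear_swap {a b : ℕ} {M : Term} : Linear (swap a b M) ↔ Linear M := linear_perm _ _

/-- Renaming a variable by a fresh one, with the type of that variable in the context. -/
theorem ty_swap {x x' : ℕ} {M : Term} (hx : x' ∉ fv M) {n : ℕ} {Γ : MCx} {S : Multiset FTy}
    {F : FTy} : Ty (swap x x' M) n (update Γ x' S) F ↔ Ty M n (update Γ x S) F := by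
  have key : ∀ u ∈ fv M, (update Γ x' S ∘ Equiv.swap x x') u = update Γ x S u := by
    intro u hu
    have hux' : u ≠ x' := fun e => hx (e ▸ hu)
    by_cases hux : u = x
    · subst hux; simp
    · simp [Equiv.swap_apply_of_ne_of_ne hux hux', hux, hux']
  rw [swap, Ty.perm_iff]
  exact ⟨fun h => h.congr le_rfl fun u hu => (key u hu).le,
    fun h => h.congr le_rfl fun u hu => (key u hu).ge⟩

theorem AlphaRule.sim {M M' : Term} (h : AlphaRule M M') : Sim M M' := by
  cases h with
  | @lam x x' M hx =>
    refine ⟨by simp [linear_swap, mem_fv_swap], fun hM => ⟨?_, ?_, ?_, ?_, ?_⟩⟩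
    · ext u
      simp only [Term.fv, Finset.mem_sdiff, Finset.mem_singleton, mem_fv_swap, Equiv.swap_apply_def]
      grind
    · have := (linear_lam_iff.1 hM).1.mult_eq_zero hx
      ext u
      simp only [Term.mult, mult_swap, Equiv.swap_apply_def]
      grind
    · simp [Term.cplx, swap]
    · simp [Term.pol, swap]
    · funext n Γ F
      simp only [Ty, ty_swap hx]
  | @sub x x' M N hx =>
    refine ⟨?_, fun hM => ⟨?_, ?_, ?_, ?_, ?_⟩⟩
    · simp only [linear_sub_iff, linear_swap, mem_fv_swap, Equiv.swap_apply_right]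
      simp only [Equiv.swap_apply_def]
      grind
    · ext u
      simp only [Term.fv, Finset.mem_union, Finset.mem_sdiff, Finset.mem_singleton, mem_fv_swap,
        Equiv.swap_apply_def]
      grind
    · have := (linear_sub_iff.1 hM).1.mult_eq_zero hx
      ext u
      simp only [Term.mult, mult_swap, Equiv.swap_apply_right]
      simp only [Equiv.swap_apply_def]
      grind
    · simp [Term.cplx, swap, mult_perm]
    · simp [Term.pol, swap]
    · funext n Γ F
      simp only [Ty, ty_swap hx]
  | @contrL x y y' z M hxy hxz hyz hy' hyx hyz' =>
    refine ⟨?_, fun hM => ⟨?_, ?_, ?_, ?_, ?_⟩⟩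
    · simp only [linear_contr_iff, linear_swap, mem_fv_swap, Equiv.swap_apply_right]
      simp only [Equiv.swap_apply_def]
      grind
    · ext u
      simp only [Term.fv, Finset.mem_union, Finset.mem_sdiff, Finset.mem_singleton, mem_fv_swap,
        Finset.mem_insert, Equiv.swap_apply_right, (linear_contr_iff.1 hM).2.2.1, true_or, if_true]
      simp only [Equiv.swap_apply_def]
      grind
    · have := (linear_contr_iff.1 hM).1.mult_eq_zero hy'
      ext u
      simp only [Term.mult, mult_swap, Equiv.swap_apply_right]
      simp only [Equiv.swap_apply_def]
      grind
    · simp [Term.cplx, swap]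
    · simp [Term.pol, swap]
    · funext n Γ F
      simp only [Ty, update_comm hyz, update_comm hyz', ty_swap hy']
  | @contrR x y z z' M hxy hxz hyz hz' hzx hzy =>
    refine ⟨?_, fun hM => ⟨?_, ?_, ?_, ?_, ?_⟩⟩
    · simp only [linear_contr_iff, linear_swap, mem_fv_swap, Equiv.swap_apply_right]
      simp only [Equiv.swap_apply_def]
      grind
    · ext u
      simp only [Term.fv, Finset.mem_union, Finset.mem_sdiff, Finset.mem_singleton, mem_fv_swap,
        Finset.mem_insert, Equiv.swap_apply_right, (linear_contr_iff.1 hM).2.2.2.1, or_true,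
        if_true]
      simp only [Equiv.swap_apply_def]
      grind
    · have := (linear_contr_iff.1 hM).1.mult_eq_zero hz'
      ext u
      simp only [Term.mult, mult_swap, Equiv.swap_apply_right]
      simp only [Equiv.swap_apply_def]
      grind
    · simp [Term.cplx, swap]
    · simp [Term.pol, swap]
    · funext n Γ F
      simp only [Ty, ty_swap hz']

theorem EquivRule.sim {M M' : Term} (h : EquivRule M M') : Sim M M' := by
  cases h with
  | @accAssoc w x v z y M hxy hxv hwy hwv =>
    have hlin : ∀ {w x v z y : ℕ}, x ≠ y → x ≠ v → w ≠ y → w ≠ v →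
        Linear (contr w x v (contr x z y M)) → Linear (contr w x y (contr x z v M)) := by
      intro w x v z y hxy hxv hwy hwv h
      simp only [linear_contr_iff, Term.fv] at h ⊢
      grind
    have hty : ∀ {w x v z y : ℕ}, x ≠ y → x ≠ v → w ≠ y → w ≠ v →
        Linear (contr w x v (contr x z y M)) → ∀ {n Γ F},
        Ty (contr w x v (contr x z y M)) n Γ F → Ty (contr w x y (contr x z v M)) n Γ F := by
      rintro w x v z y hxy hxv hwy hwv hM n Γ F ⟨S, T, hST, S', T', hST', h⟩
      simp only [linear_contr_iff, Term.fv] at hM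
      simp only [update_of_ne hxv, update_self] at hST'
      refine ⟨S' + T, T', ?_, S', T, by simp [hxy], h.congr le_rfl fun u hu => ?_⟩
      · rw [add_right_comm]
        exact (add_le_add_left hST' T).trans hST
      · simp only [update_apply]
        grind
    have hiff := Iff.intro (hlin hxy hxv hwy hwv (z := z)) (hlin hxv hxy hwv hwy (z := z))
    refine ⟨hiff, fun hM => ?_⟩
    have hM' := hiff.1 hM
    refine ⟨?_, ?_, rfl, rfl, ?_⟩
    · simp only [linear_contr_iff] at hM hM'
      ext u
      rw [mem_fv_contr hM.2.2.1, mem_fv_contr hM.1.2.2.1, mem_fv_contr hM'.2.2.1,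
        mem_fv_contr hM'.1.2.2.1]
      grind
    · simp only [linear_contr_iff, Term.fv] at hM
      ext u
      simp only [Term.mult]
      grind
    · funext n Γ F
      exact propext ⟨hty hxy hxv hwy hwv hM, hty hxv hxy hwv hwy hM'⟩
  | @accComm x y z M =>
    refine ⟨by simp only [linear_contr_iff]; grind, fun hM => ⟨?_, ?_, rfl, rfl, ?_⟩⟩
    · simp only [Term.fv, or_comm, Finset.pair_comm]
    · ext u
      simp only [Term.mult, or_comm, add_comm]
    · simp only [linear_contr_iff] at hM
      funext n Γ F
      simp only [Ty]
      rw [exists_comm]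
      simp only [update_comm hM.2.1, add_comm]
  | @accSwap x y z x' y' z' M h₁ h₂ h₃ h₄ =>
    have hlin : ∀ {x y z x' y' z' : ℕ}, x ≠ y' → x ≠ z' → x' ≠ y → x' ≠ z →
        Linear (contr x' y' z' (contr x y z M)) → Linear (contr x y z (contr x' y' z' M)) := by
      intro x y z x' y' z' h₁ h₂ h₃ h₄ h
      simp only [linear_contr_iff, Term.fv] at h ⊢
      grind
    have hty : ∀ {x y z x' y' z' : ℕ}, x ≠ y' → x ≠ z' → x' ≠ y → x' ≠ z →
        Linear (contr x' y' z' (contr x y z M)) → ∀ {n Γ F},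
        Ty (contr x' y' z' (contr x y z M)) n Γ F → Ty (contr x y z (contr x' y' z' M)) n Γ F := by
      rintro x y z x' y' z' h₁ h₂ h₃ h₄ hM n Γ F ⟨S, T, hST, S', T', hST', h⟩
      simp only [linear_contr_iff, Term.fv] at hM
      simp only [update_of_ne h₁, update_of_ne h₂] at hST'
      refine ⟨S', T', hST', S, T, by simpa [h₃, h₄] using hST, h.congr le_rfl fun u hu => ?_⟩
      simp only [update_apply]
      grind
    have hiff := Iff.intro (hlin h₁ h₂ h₃ h₄) (hlin h₃ h₄ h₁ h₂)
    refine ⟨hiff, fun hM => ?_⟩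
    have hM' := hiff.1 hM
    refine ⟨?_, ?_, rfl, ?_, ?_⟩
    · simp only [linear_contr_iff] at hM hM'
      ext u
      rw [mem_fv_contr hM.2.2.1, mem_fv_contr hM.1.2.2.1, mem_fv_contr hM'.2.2.1,
        mem_fv_contr hM'.1.2.2.1]
      grind
    · simp only [linear_contr_iff] at hM
      rw [mem_fv_contr hM.1.2.2.1, mem_fv_contr hM.1.2.2.1, mem_fv_contr hM.1.2.2.1] at hM
      ext u
      simp only [Term.mult]
      grind
    · rfl
    · funext n Γ F
      exact propext ⟨hty h₁ h₂ h₃ h₄ hM, hty h₃ h₄ h₁ h₂ hM'⟩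
  | @acw x y M =>
    refine ⟨?_, fun hM => ⟨?_, ?_, rfl, rfl, ?_⟩⟩
    · simp only [linear_weak_iff, Term.fv, Finset.mem_union, Finset.mem_singleton]
      grind
    · simp only [Term.fv, Finset.union_right_comm]
    · ext u
      simp only [Term.mult]
      grind
    · funext n Γ F
      simp only [Ty, and_left_comm]
  | @csSub x y M N₁ N₂ hy hx =>
    have hlin : ∀ {x y : ℕ} {N₁ N₂ : Term}, y ∉ fv N₁ → x ∉ fv N₂ →
        Linear (sub (sub M x N₁) y N₂) → Linear (sub (sub M y N₂) x N₁) := by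
      intro x y N₁ N₂ hy hx h
      simp only [linear_sub_iff, Term.fv, Finset.mem_union, Finset.mem_sdiff,
        Finset.mem_singleton] at h ⊢
      grind
    have hty : ∀ {x y : ℕ} {N₁ N₂ : Term}, y ∉ fv N₁ → x ∉ fv N₂ →
        Linear (sub (sub M x N₁) y N₂) → ∀ {n Γ F},
        Ty (sub (sub M x N₁) y N₂) n Γ F → Ty (sub (sub M y N₂) x N₁) n Γ F := by
      rintro x y N₁ N₂ hy hx hM n Γ F ⟨S, a, b, hab, hS, ⟨T, a', b', hab', hT, h, h₁⟩, h₂⟩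
      have hxy : x ≠ y := by
        rintro rfl
        simp only [linear_sub_iff, Term.fv, Finset.mem_union, Finset.mem_sdiff,
          Finset.mem_singleton] at hM
        grind
      rw [Bag.update_iff hy] at h₁
      rw [update_comm hxy.symm] at h
      exact ⟨T, a' + b, b', by omega, hT, ⟨S, a', b, le_rfl, hS, h, (Bag.update_iff hx).2 h₂⟩, h₁⟩
    have hiff := Iff.intro (hlin hy hx) (hlin hx hy)
    refine ⟨hiff, fun hM => ?_⟩
    have hM' := hiff.1 hM
    have hx0 := (linear_sub_iff.1 hM).2.1.mult_eq_zero hx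
    have hy0 := (linear_sub_iff.1 (linear_sub_iff.1 hM).1).2.1.mult_eq_zero hy
    have hxy : x ≠ y := by
      rintro rfl
      simp only [linear_sub_iff, Term.fv, Finset.mem_union, Finset.mem_sdiff,
        Finset.mem_singleton] at hM
      grind
    refine ⟨?_, ?_, ?_, ?_, ?_⟩
    · ext u
      simp only [Term.fv, Finset.mem_union, Finset.mem_sdiff, Finset.mem_singleton]
      grind
    · ext u
      simp only [Term.mult, if_neg hx, if_neg hy, if_neg hxy, if_neg hxy.symm]
      grind
    · simp only [Term.cplx, Term.mult, if_neg hx, if_neg hy, if_neg hxy, if_neg hxy.symm]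
      ring
    · simp only [Term.pol]
      ring
    · funext n Γ F
      exact propext ⟨hty hy hx hM, hty hx hy hM'⟩
  | @csContr w y z x M N hxw hy hz =>
    have hiff : Linear (sub (contr w y z M) x N) ↔ Linear (contr w y z (sub M x N)) := by
      simp only [linear_contr_iff, linear_sub_iff, Term.fv, Finset.mem_union, Finset.mem_sdiff,
        Finset.mem_singleton]
      constructor
      · rintro ⟨⟨hM, hyz, hyM, hzM, hwM⟩, hN, hx, hd⟩
        simp only [hyM, true_or, if_true, Finset.mem_union, Finset.mem_sdiff, Finset.mem_singleton,
          Finset.mem_insert] at hx hd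
        grind
      · rintro ⟨⟨hM, hN, hxM, hd⟩, hyz, hyM, hzM, hwM⟩
        have hyM' : y ∈ fv M := by grind
        simp only [hyM', true_or, if_true, Finset.mem_union, Finset.mem_sdiff,
          Finset.mem_singleton, Finset.mem_insert]
        grind
    refine ⟨hiff, fun hM => ?_⟩
    have hM' := hM
    rw [linear_sub_iff, linear_contr_iff] at hM'
    obtain ⟨⟨hM₀, hyz, hyM, hzM, hwM⟩, hN, hx, hd⟩ := hM'
    rw [mem_fv_contr hyM] at hx
    have hwN : w ∉ fv N := hd w (by simp [mem_fv_contr hyM]) hxw.symm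
    have hxy : x ≠ y := by tauto
    have hxz : x ≠ z := by tauto
    refine ⟨?_, ?_, ?_, ?_, ?_⟩
    · have : y ∈ fv (sub M x N) := by simp [Term.fv, hyM, hxy.symm]
      ext u
      rw [mem_fv_contr this]
      simp only [Term.fv, hyM, Finset.mem_union, Finset.mem_sdiff, Finset.mem_singleton,
        true_or, if_true, Finset.mem_insert]
      grind
    · ext u
      simp only [Term.mult, if_neg hxw, hxy, hxz, or_self, if_false, if_neg hy, if_neg hz,
        if_neg hxy.symm, if_neg hxz.symm]
      grind
    · simp [Term.cplx, Term.mult, hxw, hxy, hxz]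
    · simp only [Term.pol]
      ring
    · funext n Γ F
      refine propext ⟨?_, ?_⟩
      · rintro ⟨S, a, b, hab, hS, ⟨T₁, T₂, hT, h⟩, hb⟩
        rw [update_of_ne hxw.symm] at hT
        refine ⟨T₁, T₂, hT, S, a, b, hab, hS, ?_, (Bag.update_iff hz).2 ((Bag.update_iff hy).2 hb)⟩
        rwa [update_comm hxz.symm, update_comm hxy.symm]
      · rintro ⟨T₁, T₂, hT, S, a, b, hab, hS, h, hb⟩
        rw [Bag.update_iff hz, Bag.update_iff hy] at hb
        refine ⟨S, a, b, hab, hS, ⟨T₁, T₂, by rwa [update_of_ne hxw.symm], ?_⟩, hb⟩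
        rwa [update_comm hxz.symm, update_comm hxy.symm] at h

theorem Equiv.sim {M M' : Term} (h : Equiv M M') : Sim M M' := by
  induction h with
  | rel _ _ h => exact Sim.of_ctxt (fun _ _ h => h.elim AlphaRule.sim EquivRule.sim) h
  | refl M => exact .refl M
  | symm _ _ _ ih => exact ih.symm
  | trans _ _ _ _ _ ih₁ ih₂ => exact ih₁.trans ih₂

/-! ### Iterated weakenings, contractions and renamings -/

theorem mem_fv_weaks {X : List ℕ} {M : Term} {u : ℕ} :
    u ∈ fv (weaks X M) ↔ u ∈ X ∨ u ∈ fv M := by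
  induction X with
  | nil => simp [weaks]
  | cons x X ih =>
    change u ∈ fv (weaks X M) ∪ {x} ↔ _
    simp only [Finset.mem_union, ih, List.mem_cons, Finset.mem_singleton]
    tauto

theorem linear_weaks {X : List ℕ} {M : Term} (hX : X.Nodup) (hM : Linear M)
    (h : ∀ u ∈ X, u ∉ fv M) : Linear (weaks X M) := by
  induction X with
  | nil => exact hM
  | cons x X ih =>
    rw [List.nodup_cons] at hX
    refine .weak (ih hX.2 fun u hu => h u (by simp [hu])) fun hx => ?_
    rcases mem_fv_weaks.1 hx with hx | hx
    · exact hX.1 hx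
    · exact h x (by simp) hx

theorem mult_weaks (X : List ℕ) (M : Term) (u : ℕ) :
    mult (weaks X M) u = if u ∈ X then 1 else mult M u := by
  induction X with
  | nil => simp [weaks]
  | cons x X ih =>
    change (if u = x then 1 else mult (weaks X M) u) = _
    simp only [ih, List.mem_cons]
    grind

theorem cplx_weaks (X : List ℕ) (M : Term) : cplx (weaks X M) = cplx M := by
  induction X with
  | nil => rfl
  | cons x X ih => exact ih

theorem ty_weaks {X : List ℕ} {M : Term} {n : ℕ} {Γ : MCx} {F : FTy} (hX : ∀ u ∈ X, Γ u ≠ 0)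
    (h : Ty M n Γ F) : Ty (weaks X M) n Γ F := by
  induction X with
  | nil => exact h
  | cons x X ih => exact ⟨hX x (by simp), ih fun u hu => hX u (by simp [hu])⟩

/-- The permutation by which `swaps L` acts. -/
def swapsPerm (L : List (ℕ × ℕ)) : Equiv.Perm ℕ :=
  L.foldr (fun p π => Equiv.swap p.1 p.2 * π) 1

theorem perm_one (M : Term) : perm 1 M = M := by
  induction M <;> simp_all [perm]

theorem perm_mul (π σ : Equiv.Perm ℕ) (M : Term) : perm (π * σ) M = perm π (perm σ M) := by
  induction M <;> simp_all [perm]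

theorem swaps_eq_perm (L : List (ℕ × ℕ)) (M : Term) : swaps L M = perm (swapsPerm L) M := by
  induction L with
  | nil => exact (perm_one M).symm
  | cons p L ih =>
    change swap p.1 p.2 (swaps L M) = perm (Equiv.swap p.1 p.2 * swapsPerm L) M
    rw [ih, perm_mul, swap]

theorem swapsPerm_of_notMem {L : List (ℕ × ℕ)} {u : ℕ} (h : ∀ p ∈ L, u ≠ p.1 ∧ u ≠ p.2) :
    swapsPerm L u = u := by
  induction L with
  | nil => rfl
  | cons p L ih =>
    change Equiv.swap p.1 p.2 (swapsPerm L u) = u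
    rw [ih fun q hq => h q (by simp [hq])]
    exact Equiv.swap_apply_of_ne_of_ne (h p (by simp)).1 (h p (by simp)).2

theorem swapsPerm_apply {L : List (ℕ × ℕ)} (h₁ : (L.map Prod.fst).Nodup)
    (h₂ : (L.map Prod.snd).Nodup) (h : ∀ p ∈ L, ∀ q ∈ L, p.1 ≠ q.2) {p : ℕ × ℕ} (hp : p ∈ L) :
    swapsPerm L p.1 = p.2 := by
  induction L with
  | nil => simp at hp
  | cons q L ih =>
    simp only [List.map_cons, List.nodup_cons, List.mem_map, not_exists, not_and] at h₁ h₂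
    change Equiv.swap q.1 q.2 (swapsPerm L p.1) = p.2
    rcases List.mem_cons.1 hp with rfl | hp'
    · rw [swapsPerm_of_notMem fun r hr =>
          ⟨fun e => h₁.1 r hr e.symm, h _ (by simp) r (by simp [hr])⟩,
        Equiv.swap_apply_left]
    · rw [ih h₁.2 h₂.2 (fun r hr s hs => h r (by simp [hr]) s (by simp [hs])) hp']
      exact Equiv.swap_apply_of_ne_of_ne (h q (by simp) p hp).symm fun e => h₂.1 p hp' e

/-- A list of triples `(xᵢ, yᵢ, zᵢ)` in which all entries are distinct. -/
structure Distinct (L : List (ℕ × ℕ × ℕ)) : Prop where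
  fst : (L.map fun t => t.1).Nodup
  snd : ((L.map fun t => t.2.1) ++ (L.map fun t => t.2.2)).Nodup
  ne : ∀ s ∈ L, ∀ t ∈ L, s.1 ≠ t.2.1 ∧ s.1 ≠ t.2.2

theorem Distinct.snd_ne {L : List (ℕ × ℕ × ℕ)} (h : Distinct L) {s t : ℕ × ℕ × ℕ} (hs : s ∈ L)
    (ht : t ∈ L) : s.2.1 ≠ t.2.2 :=
  (List.nodup_append.1 h.snd).2.2 _ (List.mem_map_of_mem hs) _ (List.mem_map_of_mem ht)

theorem Distinct.tail {t : ℕ × ℕ × ℕ} {L : List (ℕ × ℕ × ℕ)} (h : Distinct (t :: L)) :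
    Distinct L := by
  refine ⟨(List.nodup_cons.1 h.fst).2, ?_, fun s hs s' hs' =>
    h.ne s (by simp [hs]) s' (by simp [hs'])⟩
  have := List.nodup_append.1 h.snd
  simp only [List.map_cons, List.nodup_cons] at this
  refine List.nodup_append.2 ⟨this.1.2, this.2.1.2, fun a ha b hb => ?_⟩
  exact this.2.2 a (by simp_all) b (by simp_all)

theorem Distinct.head {t s : ℕ × ℕ × ℕ} {L : List (ℕ × ℕ × ℕ)} (h : Distinct (t :: L))
    (hs : s ∈ L) : s.1 ≠ t.1 ∧ s.2.1 ≠ t.2.1 ∧ s.2.2 ≠ t.2.2 := by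
  have h₁ := List.nodup_cons.1 h.fst
  have h₂ := List.nodup_append.1 h.snd
  simp only [List.map_cons, List.nodup_cons] at h₂
  exact ⟨fun e => h₁.1 (List.mem_map.2 ⟨s, hs, e⟩), fun e => h₂.1.1 (List.mem_map.2 ⟨s, hs, e⟩),
    fun e => h₂.2.1.1 (List.mem_map.2 ⟨s, hs, e⟩)⟩

theorem linear_contrs {L : List (ℕ × ℕ × ℕ)} {P : Term} (hL : Distinct L) (hP : Linear P)
    (h : ∀ t ∈ L, t.1 ∉ fv P ∧ t.2.1 ∈ fv P ∧ t.2.2 ∈ fv P) :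
    Linear (contrs L P) ∧ ∀ u, u ∈ fv (contrs L P) ↔
      (u ∈ fv P ∧ ∀ t ∈ L, u ≠ t.2.1 ∧ u ≠ t.2.2) ∨ ∃ t ∈ L, u = t.1 := by
  induction L with
  | nil => exact ⟨hP, fun u => by simp [contrs]⟩
  | cons t L ih =>
    obtain ⟨hlin, hfv⟩ := ih hL.tail fun s hs => h s (by simp [hs])
    have ht := h t (by simp)
    have hy : t.2.1 ∈ fv (contrs L P) := (hfv _).2 (.inl ⟨ht.2.1, fun s hs =>
      ⟨(hL.head hs).2.1.symm, hL.snd_ne (by simp) (by simp [hs])⟩⟩)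
    have hz : t.2.2 ∈ fv (contrs L P) := (hfv _).2 (.inl ⟨ht.2.2, fun s hs =>
      ⟨(hL.snd_ne (by simp [hs]) (by simp)).symm, (hL.head hs).2.2.symm⟩⟩)
    have hx : t.1 ∉ fv (contrs L P) := fun hx => by
      rcases (hfv _).1 hx with hx | ⟨s, hs, e⟩
      · exact ht.1 hx.1
      · exact (hL.head hs).1 e.symm
    refine ⟨.contr hlin (hL.snd_ne (by simp) (by simp)) hy hz hx, fun u => ?_⟩
    change u ∈ fv (contr t.1 t.2.1 t.2.2 (contrs L P)) ↔ _
    rw [mem_fv_contr hy, hfv]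
    have hne : ∀ s ∈ L, s.1 ≠ t.2.1 ∧ s.1 ≠ t.2.2 := fun s hs => hL.ne s (by simp [hs]) t (by simp)
    simp only [List.forall_mem_cons, List.exists_mem_cons_iff]
    grind

theorem mult_contrs_of_ne {L : List (ℕ × ℕ × ℕ)} {P : Term} {u : ℕ}
    (h : ∀ t ∈ L, u ≠ t.1 ∧ u ≠ t.2.1 ∧ u ≠ t.2.2) : mult (contrs L P) u = mult P u := by
  induction L with
  | nil => rfl
  | cons t L ih =>
    change mult (contr t.1 t.2.1 t.2.2 (contrs L P)) u = _
    have ht := h t (by simp)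
    simp only [mult, if_neg ht.1, ht.2.1, ht.2.2, or_self, if_false]
    exact ih fun s hs => h s (by simp [hs])

theorem mult_contrs_of_mem {L : List (ℕ × ℕ × ℕ)} {P : Term} (hL : Distinct L)
    {t : ℕ × ℕ × ℕ} (ht : t ∈ L) :
    mult (contrs L P) t.1 = mult P t.2.1 + mult P t.2.2 + 1 := by
  induction L with
  | nil => simp at ht
  | cons s L ih =>
    change mult (contr s.1 s.2.1 s.2.2 (contrs L P)) t.1 = _
    rcases List.mem_cons.1 ht with rfl | ht'
    · simp only [mult, if_true]
      rw [mult_contrs_of_ne fun s hs => ⟨(hL.ne s (by simp [hs]) t (by simp)).1.symm,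
          (hL.head hs).2.1.symm, hL.snd_ne (by simp) (by simp [hs])⟩,
        mult_contrs_of_ne fun s hs => ⟨(hL.ne s (by simp [hs]) t (by simp)).2.symm,
          (hL.snd_ne (by simp [hs]) (by simp)).symm, (hL.head hs).2.2.symm⟩]
    · have h₁ := hL.head ht'
      have h₂ := hL.ne t ht s (by simp)
      simp only [mult, if_neg h₁.1, h₂.1, h₂.2, or_self, if_false]
      exact ih hL.tail ht'

theorem cplx_contrs (L : List (ℕ × ℕ × ℕ)) (P : Term) : cplx (contrs L P) = cplx P := by
  induction L with
  | nil => rfl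
  | cons t L ih => exact ih

theorem ty_contrs {L : List (ℕ × ℕ × ℕ)} {P : Term} (hL : Distinct L) {n : ℕ} {Γ Γ' : MCx}
    {F : FTy} (h : Ty P n Γ' F)
    (h₁ : ∀ u, (∀ t ∈ L, u ≠ t.2.1 ∧ u ≠ t.2.2) → Γ' u ≤ Γ u)
    (h₂ : ∀ t ∈ L, Γ' t.2.1 + Γ' t.2.2 ≤ Γ t.1) : Ty (contrs L P) n Γ F := by
  induction L generalizing Γ with
  | nil => exact h.congr le_rfl fun u _ => h₁ u (by simp)
  | cons t L ih =>
    refine ⟨Γ' t.2.1, Γ' t.2.2, h₂ t (by simp), ih hL.tail (fun u hu => ?_) fun s hs => ?_⟩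
    · by_cases hz : u = t.2.2
      · simp [hz]
      by_cases hy : u = t.2.1
      · simp [hy, hL.snd_ne (s := t) (t := t) (by simp) (by simp)]
      · simpa [hy, hz] using h₁ u (by simpa [hy, hz] using hu)
    · have := hL.ne s (by simp [hs]) t (by simp)
      rw [update_of_ne this.2, update_of_ne this.1]
      exact h₂ s (by simp [hs])

end Term

/-! ### Typings of the components of an intersection -/

theorem Bag.ne_zero {M : Term} (hM : M.Linear) {n : ℕ} {Γ : MCx} {S : Multiset FTy}
    (h : Bag (Ty M) n Γ S) (hS : S ≠ 0) {u : ℕ} (hu : u ∈ M.fv) : Γ u ≠ 0 :=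
  h.apply_ne_zero hS fun _ _ _ h => h.ne_zero hM hu

/-- A contraction can be pushed into each of the derivations of an intersection: each of them
takes for `w` the types that it uses for `y` and `z`. -/
theorem Bag.contr {M : Term} {w y z : ℕ} (hw : w ∉ M.fv) (hy : y ∈ M.fv) {n : ℕ} {Γ : MCx}
    {S T₁ T₂ : Multiset FTy} (hyz : y ≠ z) (hT : T₁ + T₂ ≤ Γ w)
    (h : Bag (Ty M) n (update (update Γ y T₁) z T₂) S) :
    Bag (Ty (.contr w y z M)) n Γ S := by
  have := h.map (Q := Ty (.contr w y z M)) (φ := fun Γ => update Γ w (Γ y + Γ z))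
    (fun Δ Θ Γ h u => by
      by_cases hu : u = w
      · subst hu
        simpa [add_add_add_comm] using add_le_add (h y) (h z)
      · simpa [hu] using h u)
    fun n Γ F h => ⟨Γ y, Γ z, by simp, h.congr le_rfl fun u hu => by
      have huw : u ≠ w := ne_of_mem_of_not_mem hu hw
      simp only [update_apply]
      grind⟩
  refine this.congr le_rfl fun u hu => ?_
  rw [Term.mem_fv_contr hy] at hu
  by_cases huw : u = w
  · subst huw; simpa [hyz] using hT
  · have := hu.resolve_right huw
    simp [huw, this.2.1, this.2.2]

/-- A substitution can be pushed into each of the derivations of an intersection: each of them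
takes those derivations of the substituted term that it uses. -/
theorem Bag.sub {M N : Term} {x : ℕ} (hM : M.Linear) (hx : x ∈ M.fv) {a b : ℕ} {Γ Δ : MCx}
    {S : Multiset FTy} (h : Bag (Ty M) a Γ S) (hN : Bag (Ty N) b Δ (Γ x)) :
    Bag (Ty (.sub M x N)) (a + b) (update Γ x 0 + Δ) S := by
  induction h generalizing b Δ with
  | nil => exact .nil _ _
  | @cons a a₁ a₂ Γ Γ₁ Γ₂ F S h₁ _ ha hΓ ih =>
    obtain ⟨b₁, b₂, Δ₁, Δ₂, hb, hΔ, hN₁, hN₂⟩ := hN.split (hΓ x)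
    refine .cons (a := a₁ + b₁) (Δ := update Γ₁ x 0 + Δ₁)
      ⟨Γ₁ x, a₁, b₁, le_rfl, h₁.ne_zero hM hx, h₁.congr le_rfl fun u _ => ?_,
        hN₁.mono le_rfl (le_add_of_nonneg_left zero_le)⟩ (ih hN₂) (by omega) fun u => ?_
    · by_cases hu : u = x
      · subst hu; simp
      · simp [hu]
    · have h₁ := hΔ u
      have h₂ := hΓ u
      simp only [Pi.add_apply] at h₁ h₂ ⊢
      rw [add_add_add_comm]
      refine add_le_add ?_ h₁
      by_cases hu : u = x
      · subst hu; simp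
      · simpa [hu] using h₂

/-- As `Bag.sub`, with both bags in one context, as in the rules of `Ty`: its types are divided
between `M` and `N` according to their free variables. -/
theorem Bag.sub_of_disjoint {M N : Term} {x : ℕ} (hM : M.Linear) (hx : x ∈ M.fv)
    (hd : ∀ u ∈ M.fv, u ≠ x → u ∉ N.fv) {a b : ℕ} {Γ : MCx}
    {S T : Multiset FTy} (h : Bag (Ty M) a (update Γ x T) S) (hN : Bag (Ty N) b Γ T) :
    Bag (Ty (.sub M x N)) (a + b) Γ S := by
  have h' : Bag (Ty M) a (update (fun u => if u ∈ M.fv then Γ u else 0) x T) S :=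
    h.congr le_rfl fun u hu => update_le_update _ fun _ => by simp [hu]
  have hN' : Bag (Ty N) b (fun u => if u ∈ N.fv then Γ u else 0) T :=
    hN.congr le_rfl fun u hu => by simp [hu]
  refine (h'.sub hM hx (by simpa using hN')).mono le_rfl fun u => ?_
  by_cases hux : u = x
  · subst hux
    by_cases huN : u ∈ N.fv <;> simp [huN]
  · by_cases huM : u ∈ M.fv
    · simp [hux, huM, hd u huM hux]
    · by_cases huN : u ∈ N.fv <;> simp [hux, huM, huN]

namespace Term

/-! ### Duplication -/

/-- `IsCopy f L N N'`: the term `N'` is obtained from `N` by renaming its free variables, which are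
those enumerated by the first entries of `L`, to the variables enumerated by `f`. -/
structure IsCopy (f : ℕ × ℕ × ℕ → ℕ) (L : List (ℕ × ℕ × ℕ)) (N N' : Term) : Prop where
  linear : Linear N → Linear N'
  mem_fv : ∀ u, u ∈ fv N' ↔ ∃ t ∈ L, u = f t
  mult : ∀ t ∈ L, mult N' (f t) = mult N t.1
  cplx : cplx N' = cplx N
  bag : ∀ {n : ℕ} {Γ Γ' : MCx} {S : Multiset FTy}, Bag (Ty N) n Γ S →
    (∀ t ∈ L, Γ t.1 ≤ Γ' (f t)) → Bag (Ty N') n Γ' S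

theorem isCopy_swaps {f : ℕ × ℕ × ℕ → ℕ} {L : List (ℕ × ℕ × ℕ)} {N : Term}
    (h₁ : (L.map fun t => t.1).Nodup) (hN : (L.map fun t => t.1).toFinset = fv N)
    (h₂ : (L.map f).Nodup) (h : ∀ s ∈ L, ∀ t ∈ L, s.1 ≠ f t) :
    IsCopy f L N (swaps (L.map fun t => (t.1, f t)) N) := by
  have hfv : ∀ u, u ∈ fv N ↔ ∃ t ∈ L, u = t.1 := by
    intro u
    rw [← hN]
    simp [eq_comm]
  have hπ : ∀ t ∈ L, swapsPerm (L.map fun t => (t.1, f t)) t.1 = f t := by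
    intro t ht
    refine swapsPerm_apply (p := (t.1, f t)) (by simpa [comp_def] using h₁)
      (by simpa [comp_def] using h₂) ?_ (List.mem_map.2 ⟨t, ht, rfl⟩)
    intro p hp q hq
    obtain ⟨s, hs, rfl⟩ := List.mem_map.1 hp
    obtain ⟨t, ht, rfl⟩ := List.mem_map.1 hq
    exact h s hs t ht
  rw [swaps_eq_perm]
  generalize swapsPerm (L.map fun t => (t.1, f t)) = π at hπ
  refine ⟨(linear_perm π N).2, fun u => ?_, fun t ht => ?_, cplx_perm π N, fun hb hΓ => ?_⟩
  · rw [mem_fv_perm, hfv]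
    refine exists_congr fun t => and_congr_right fun ht => ?_
    rw [Equiv.symm_apply_eq, hπ t ht]
  · rw [mult_perm, ← hπ t ht, Equiv.symm_apply_apply]
  · refine Bag.perm_iff.2 (hb.congr le_rfl fun u hu => ?_)
    obtain ⟨t, ht, rfl⟩ := (hfv u).1 hu
    simpa [hπ t ht] using hΓ t ht

/-- What the termination proof needs to know of a reduction step from a linear term that does not
fire a redex `(λx.M)N`: typings are preserved, multiplicities do not increase, and the two other
measures decrease lexicographically. -/
structure Propagates (M M' : Term) : Prop where
  ty : ∀ n Γ F, Ty M n Γ F → Ty M' n Γ F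
  mult : ∀ u, mult M' u ≤ mult M u
  cplx : cplx M' ≤ cplx M
  lt : Term.cplx M' < Term.cplx M ∨ pol M' < pol M

/-- `N₁` and `N₂` are the two copies of `N`, with free variables renamed according to `L`, that are
made when the substitution of `N` for `x` meets the contraction `C_x^{y,z}(M)`. -/
structure IsDuplicate (x y z : ℕ) (M N N₁ N₂ : Term) (L : List (ℕ × ℕ × ℕ)) : Prop where
  distinct : Distinct L
  mem_fv : ∀ u, u ∈ fv N ↔ ∃ t ∈ L, u = t.1
  fresh : ∀ t ∈ L, (t.2.1 ∉ fv M ∧ t.2.1 ∉ fv N ∧ t.2.1 ≠ x ∧ t.2.1 ≠ y ∧ t.2.1 ≠ z) ∧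
    t.2.2 ∉ fv M ∧ t.2.2 ∉ fv N ∧ t.2.2 ≠ x ∧ t.2.2 ≠ y ∧ t.2.2 ≠ z
  copy₁ : IsCopy (fun t => t.2.1) L N N₁
  copy₂ : IsCopy (fun t => t.2.2) L N N₂

variable {x y z : ℕ} {M N N₁ N₂ : Term} {L : List (ℕ × ℕ × ℕ)}

theorem IsDuplicate.linear (h : IsDuplicate x y z M N N₁ N₂ L)
    (hM : Linear (sub (contr x y z M) x N)) : Linear (contrs L (sub (sub M y N₁) z N₂)) ∧
    fv (contrs L (sub (sub M y N₁) z N₂)) = fv (sub (contr x y z M) x N) := by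
  obtain ⟨hL, hfv, hfresh, h₁, h₂⟩ := h
  rw [linear_sub_iff, linear_contr_iff] at hM
  obtain ⟨⟨hM, hyz, hy, hz, hx⟩, hN, -, hd⟩ := hM
  simp only [mem_fv_contr hy] at hd
  have hf₁ := h₁.mem_fv
  have hf₂ := h₂.mem_fv
  have hP : Linear (sub (sub M y N₁) z N₂) := by
    simp only [linear_sub_iff, Term.fv, Finset.mem_union, Finset.mem_sdiff, Finset.mem_singleton]
    refine ⟨⟨hM, h₁.linear hN, hy, fun u hu hne huN => ?_⟩, h₂.linear hN, .inl ⟨hz, hyz.symm⟩,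
      fun u hu hne huN => ?_⟩
    · obtain ⟨t, ht, rfl⟩ := (hf₁ u).1 huN
      exact (hfresh t ht).1.1 hu
    · obtain ⟨t, ht, rfl⟩ := (hf₂ u).1 huN
      rcases hu with hu | hu
      · exact (hfresh t ht).2.1 hu.1
      · obtain ⟨s, hs, e⟩ := (hf₁ _).1 hu
        exact hL.snd_ne hs ht e.symm
  have hfP : ∀ u, u ∈ fv (sub (sub M y N₁) z N₂) ↔
      (u ∈ fv M ∧ u ≠ y ∧ u ≠ z) ∨ (∃ t ∈ L, u = t.2.1) ∨ ∃ t ∈ L, u = t.2.2 := by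
    intro u
    have : (∃ t ∈ L, u = t.2.1) → u ≠ z := by
      rintro ⟨t, ht, rfl⟩
      exact (hfresh t ht).1.2.2.2.2
    simp only [Term.fv, Finset.mem_union, Finset.mem_sdiff, Finset.mem_singleton, hf₁, hf₂,
      or_and_right, or_assoc, and_assoc, and_iff_left_of_imp this, ne_eq]
  have := linear_contrs hL hP fun t ht => ⟨fun h => ?_, (hfP _).2 (.inr (.inl ⟨t, ht, rfl⟩)),
    (hfP _).2 (.inr (.inr ⟨t, ht, rfl⟩))⟩
  · refine ⟨this.1, ?_⟩
    ext u
    rw [this.2, hfP]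
    simp only [Term.fv, hy, true_or, if_true, Finset.mem_union, Finset.mem_sdiff,
      Finset.mem_singleton, Finset.mem_insert, hfv]
    have : u ∈ fv M → ∀ t ∈ L, u ≠ t.2.1 ∧ u ≠ t.2.2 := fun hu t ht =>
      ⟨fun e => (hfresh t ht).1.1 (e ▸ hu), fun e => (hfresh t ht).2.1 (e ▸ hu)⟩
    have hux : u ∈ fv M → u ≠ x := fun hu e => hx (e ▸ hu)
    constructor
    · rintro (⟨h | ⟨t, ht, e⟩ | ⟨t, ht, e⟩, h'⟩ | h)
      · exact .inl ⟨.inl ⟨h.1, by tauto⟩, hux h.1⟩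
      · exact absurd e (h' t ht).1
      · exact absurd e (h' t ht).2
      · exact .inr h
    · rintro (⟨⟨h, h'⟩ | h, h''⟩ | h)
      · exact .inl ⟨.inl ⟨h, by tauto⟩, this h⟩
      · exact absurd h h''
      · exact .inr h
  · have htN : t.1 ∈ fv N := (hfv _).2 ⟨t, ht, rfl⟩
    rcases (hfP _).1 h with h | ⟨s, hs, e⟩ | ⟨s, hs, e⟩
    · exact hd t.1 (.inl h) (fun e => hx (e ▸ h.1)) htN
    · exact (hL.ne t ht s hs).1 e
    · exact (hL.ne t ht s hs).2 e

theorem IsDuplicate.propagates (h : IsDuplicate x y z M N N₁ N₂ L)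
    (hM : Linear (sub (contr x y z M) x N)) :
    Propagates (sub (contr x y z M) x N) (contrs L (sub (sub M y N₁) z N₂)) := by
  have hlin := h.linear hM
  obtain ⟨hL, hfv, hfresh, h₁, h₂⟩ := h
  rw [linear_sub_iff, linear_contr_iff] at hM
  obtain ⟨⟨hM, hyz, hy, hz, hx⟩, hN, -, hd⟩ := hM
  have hf₁ := h₁.mem_fv
  have hf₂ := h₂.mem_fv
  have hN₁ := h₁.linear hN
  have hN₂ := h₂.linear hN
  have hyN₁ : y ∉ fv N₁ := fun h => by
    obtain ⟨t, ht, e⟩ := (hf₁ _).1 h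
    exact (hfresh t ht).1.2.2.2.1 e.symm
  have hzN₁ : z ∉ fv N₁ := fun h => by
    obtain ⟨t, ht, e⟩ := (hf₁ _).1 h
    exact (hfresh t ht).1.2.2.2.2 e.symm
  have hc : Term.mult (sub M y N₁) z = Term.mult M z := by
    simp [Term.mult, hzN₁, hyz.symm]
  have hcplx : Term.cplx (contrs L (sub (sub M y N₁) z N₂)) <
      Term.cplx (sub (contr x y z M) x N) := by
    rw [cplx_contrs]
    simp only [Term.cplx, hc, h₁.cplx, h₂.cplx]
    simp only [Term.mult, if_true]
    have := one_le_cplx N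
    nlinarith
  refine ⟨?_, fun u => ?_, hcplx.le, .inl hcplx⟩
  · rintro n Γ F ⟨S, a, b, hab, -, ⟨T₁, T₂, hT, h⟩, hb⟩
    rw [update_self] at hT
    have hne : ∀ {v : ℕ} {T : Multiset FTy}, v ∈ fv M →
        update (update (update Γ x S) y T₁) z T₂ v = T → T ≠ 0 :=
      fun hv e => e ▸ h.ne_zero hM hv
    have hT₁ : T₁ ≠ 0 := hne hy (by simp [hyz])
    have hT₂ : T₂ ≠ 0 := hne hz (by simp)
    obtain ⟨b₁, b₂, Γ₁, Γ₂, hb', hΓ, hb₁, hb₂⟩ := hb.split hT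
    -- The new variables take over the types that the two copies need.
    obtain ⟨Γ', hΓ'₁, hΓ'₂, hΓ'⟩ : ∃ Γ' : MCx, (∀ t ∈ L, Γ' t.2.1 = Γ₁ t.1) ∧
        (∀ t ∈ L, Γ' t.2.2 = Γ₂ t.1) ∧ ∀ u, (∀ t ∈ L, u ≠ t.2.1 ∧ u ≠ t.2.2) → Γ' u = Γ u := by
      classical
      refine ⟨fun u => if h : ∃ t ∈ L, u = t.2.1 then Γ₁ h.choose.1 else
        if h : ∃ t ∈ L, u = t.2.2 then Γ₂ h.choose.1 else Γ u, fun t ht => ?_, fun t ht => ?_,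
        fun u hu => ?_⟩
      · have h : ∃ s ∈ L, t.2.1 = s.2.1 := ⟨t, ht, rfl⟩
        have hs := h.choose_spec
        have := List.inj_on_of_nodup_map (List.nodup_append.1 hL.snd).1 ht hs.1 hs.2
        simp only [dif_pos h, ← this]
      · have h₀ : ¬ ∃ s ∈ L, t.2.2 = s.2.1 := fun ⟨s, hs, e⟩ => hL.snd_ne hs ht e.symm
        have h : ∃ s ∈ L, t.2.2 = s.2.2 := ⟨t, ht, rfl⟩
        have hs := h.choose_spec
        have := List.inj_on_of_nodup_map (List.nodup_append.1 hL.snd).2.1 ht hs.1 hs.2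
        simp only [dif_neg h₀, dif_pos h, ← this]
      · have h₀ : ¬ ∃ s ∈ L, u = s.2.1 := fun ⟨s, hs, e⟩ => (hu s hs).1 e
        have h : ¬ ∃ s ∈ L, u = s.2.2 := fun ⟨s, hs, e⟩ => (hu s hs).2 e
        simp only [dif_neg h₀, dif_neg h]
    refine ty_contrs hL (Γ' := Γ') ⟨T₂, a + b₁, b₂, by omega, hT₂,
      ⟨T₁, a, b₁, le_rfl, hT₁, h.congr le_rfl fun u hu => ?_, ?_⟩, ?_⟩ (fun u hu => (hΓ' u hu).le)
      fun t ht => ?_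
    · have hux : u ≠ x := ne_of_mem_of_not_mem hu hx
      have hu' := hΓ' u fun t ht => ⟨ne_of_mem_of_not_mem hu (hfresh t ht).1.1,
        ne_of_mem_of_not_mem hu (hfresh t ht).2.1⟩
      rw [update_comm hyz]
      exact update_le_update _ fun _ => update_le_update _ fun _ => by simp [hux, hu']
    · exact (Bag.update_iff hzN₁).2 (h₁.bag hb₁ fun t ht => (hΓ'₁ t ht).ge)
    · exact h₂.bag hb₂ fun t ht => (hΓ'₂ t ht).ge
    · rw [hΓ'₁ t ht, hΓ'₂ t ht]
      exact hΓ t.1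
  · -- The multiplicity of a free variable of `N`, which is `m` in `N`, changes from
    -- `(m_y + m_z + 1) * (m + 1)` to `m_y * (m + 1) + m_z * (m + 1) + 1`.
    by_cases hu : ∃ t ∈ L, u = t.1
    · have huN := (hfv u).2 hu
      obtain ⟨t, ht, rfl⟩ := hu
      rw [mult_contrs_of_mem hL ht]
      have hy₁ : t.2.1 ∈ fv N₁ := (hf₁ _).2 ⟨t, ht, rfl⟩
      have hy₂ : t.2.1 ∉ fv N₂ := fun h => by
        obtain ⟨s, hs, e⟩ := (hf₂ _).1 h
        exact hL.snd_ne ht hs e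
      have hz₁ : t.2.2 ∉ fv N₁ := fun h => by
        obtain ⟨s, hs, e⟩ := (hf₁ _).1 h
        exact hL.snd_ne hs ht e.symm
      have hz₂ : t.2.2 ∈ fv N₂ := (hf₂ _).2 ⟨t, ht, rfl⟩
      have h₃ := hM.mult_eq_zero (hfresh t ht).1.1
      have h₄ := hM.mult_eq_zero (hfresh t ht).2.1
      have h₅ := h₁.mult t ht
      have h₆ := h₂.mult t ht
      obtain ⟨⟨-, -, -, e₁, e₂⟩, -, -, -, e₃, e₄⟩ := hfresh t ht
      simp only [Term.mult, hy₁, hy₂, hz₁, hz₂, if_true, if_false, e₁, e₂, e₃, e₄, h₃, h₄, h₅, h₆,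
        hzN₁, huN, if_neg hyz.symm]
      refine le_add_left ?_
      linarith
    · by_cases hu' : ∀ t ∈ L, u ≠ t.2.1 ∧ u ≠ t.2.2
      · rw [mult_contrs_of_ne fun t ht => ⟨fun e => hu ⟨t, ht, e⟩, hu' t ht⟩]
        have hu₁ : u ∉ fv N₁ := fun h => by
          obtain ⟨t, ht, e⟩ := (hf₁ _).1 h
          exact (hu' t ht).1 e
        have hu₂ : u ∉ fv N₂ := fun h => by
          obtain ⟨t, ht, e⟩ := (hf₂ _).1 h
          exact (hu' t ht).2 e
        have := hM.mult_eq_zero hx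
        simp only [Term.mult, hu₁, hu₂, if_false]
        grind
      · have : u ∉ fv (contrs L (sub (sub M y N₁) z N₂)) := by
          rw [hlin.2]
          intro h
          push Not at hu'
          obtain ⟨t, ht, e⟩ := hu'
          simp only [Term.fv, Finset.mem_union, Finset.mem_sdiff, hfv, hu, or_false, hy, true_or,
            if_true, Finset.mem_singleton] at h
          have huM : u ∈ fv M := by tauto
          have := hfresh t ht
          by_cases e' : u = t.2.1
          · exact this.1.1 (e' ▸ huM)
          · exact this.2.1 (e e' ▸ huM)
        rw [hlin.1.mult_eq_zero this]
        exact Nat.zero_le _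

end Term

namespace Term

/-! ### Reduction -/

variable {M M' : Term}

theorem isDuplicate_swaps {x y z : ℕ} {L : List (ℕ × ℕ × ℕ)} {M N : Term}
    (h₁ : (L.map fun t => t.1).Nodup) (h₂ : (L.map fun t => t.1).toFinset = fv N)
    (h₃ : ((L.map fun t => t.2.1) ++ (L.map fun t => t.2.2)).Nodup)
    (h₄ : ∀ u ∈ (L.map fun t => t.2.1) ++ (L.map fun t => t.2.2),
      u ∉ fv M ∧ u ∉ fv N ∧ u ≠ x ∧ u ≠ y ∧ u ≠ z) :
    IsDuplicate x y z M N (swaps (L.map fun t => (t.1, t.2.1)) N)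
      (swaps (L.map fun t => (t.1, t.2.2)) N) L := by
  have hfv : ∀ u, u ∈ fv N ↔ ∃ t ∈ L, u = t.1 := by
    intro u
    rw [← h₂]
    simp [eq_comm]
  have hfr : ∀ t ∈ L, (t.2.1 ∉ fv M ∧ t.2.1 ∉ fv N ∧ t.2.1 ≠ x ∧ t.2.1 ≠ y ∧ t.2.1 ≠ z) ∧
      t.2.2 ∉ fv M ∧ t.2.2 ∉ fv N ∧ t.2.2 ≠ x ∧ t.2.2 ≠ y ∧ t.2.2 ≠ z := fun t ht =>
    ⟨h₄ _ (List.mem_append_left _ (List.mem_map.2 ⟨t, ht, rfl⟩)),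
      h₄ _ (List.mem_append_right _ (List.mem_map.2 ⟨t, ht, rfl⟩))⟩
  have hne : ∀ s ∈ L, ∀ t ∈ L, s.1 ≠ t.2.1 ∧ s.1 ≠ t.2.2 := fun s hs t ht =>
    have hsN := (hfv s.1).2 ⟨s, hs, rfl⟩
    ⟨ne_of_mem_of_not_mem hsN (hfr t ht).1.2.1, ne_of_mem_of_not_mem hsN (hfr t ht).2.2.1⟩
  exact ⟨⟨h₁, h₃, hne⟩, hfv, hfr,
    isCopy_swaps h₁ h₂ (List.nodup_append.1 h₃).1 fun s hs t ht => (hne s hs t ht).1,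
    isCopy_swaps h₁ h₂ (List.nodup_append.1 h₃).2.1 fun s hs t ht => (hne s hs t ht).2⟩

/-- Reduction preserves linearity and free variables. -/
theorem RedRule.linear (h : RedRule M M') (hM : Linear M) : Linear M' ∧ fv M' = fv M := by
  cases h with
  | B => exact ⟨by simpa [and_assoc, and_left_comm, Term.fv] using hM, rfl⟩
  | SR => exact ⟨(linear_sub_iff.1 hM).2.1, by simp [Term.fv]⟩
  | D h₁ h₂ h₃ h₄ => exact (isDuplicate_swaps h₁ h₂ h₃ h₄).linear hM
  | @W x M N X hX hN =>
    have hmem : ∀ u, u ∈ X ↔ u ∈ fv N := by simp [← hN]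
    simp only [linear_sub_iff, linear_weak_iff, Term.fv] at hM
    refine ⟨linear_weaks hX hM.1.1 fun u hu huM => ?_, ?_⟩
    · rw [hmem] at hu
      grind
    · ext u
      rw [mem_fv_weaks, hmem]
      simp only [Term.fv]
      grind
  | @Merge w y z M hw =>
    simp only [linear_contr_iff, linear_weak_iff, Term.fv] at hM
    refine ⟨linear_swap.2 hM.1.1, ?_⟩
    ext u
    rw [mem_fv_swap, mem_fv_contr (by simp [Term.fv])]
    simp only [Term.fv, Equiv.swap_apply_def]
    grind
  | _ =>
    simp only [linear_sub_iff, linear_contr_iff, linear_weak_iff, linear_app_iff, linear_lam_iff,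
      Term.fv, Finset.mem_union, Finset.mem_sdiff, Finset.mem_singleton] at hM ⊢
    refine ⟨by grind, ?_⟩
    ext u
    grind

theorem RedRule.ty_or (h : RedRule M M') (hM : Linear M) :
    (∀ n Γ F, Ty M n Γ F → ∃ m < n, Ty M' m Γ F) ∨ Propagates M M' := by
  cases h with
  | @B x M N =>
    left
    rintro n Γ F ⟨A, a, b, hab, ⟨A', F', e, h⟩, hb⟩
    cases e
    exact ⟨a + b, by omega, A.ms, a, b, le_rfl, A.ms_ne_zero, h, hb⟩
  | @SR x N =>
    right
    refine ⟨?_, fun u => ?_, ?_, ?_⟩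
    · rintro n Γ F ⟨S, a, b, hab, hS, h, hb⟩
      obtain ⟨m, Δ, hm, hΔ, h⟩ := hb.exists_of_mem (show F ∈ S by simpa [Ty] using h)
      exact h.congr (by omega) fun u _ => hΔ u
    · have := (linear_sub_iff.1 hM).2.1.mult_eq_zero (u := u)
      simp only [Term.mult, if_true]
      grind
    · simp [Term.cplx, Term.mult]
    · left
      simp [Term.cplx, Term.mult]
  | @SPApp1 x M₁ M₂ N hx =>
    right
    simp only [linear_sub_iff, linear_app_iff, Term.fv] at hM
    have hx₂ : x ∉ fv M₂ := by grind
    have h0 := hM.1.2.1.mult_eq_zero hx₂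
    refine ⟨?_, fun u => ?_, ?_, .inr ?_⟩
    · rintro n Γ F ⟨S, a, b, hab, hS, ⟨A, a', b', hab', h, h'⟩, hb⟩
      rw [Bag.update_iff hx₂] at h'
      exact ⟨A, a' + b, b', by omega, ⟨S, a', b, le_rfl, hS, h, hb⟩, h'⟩
    · simp only [Term.mult, h0]
      grind
    · simp only [Term.cplx, Term.mult, h0]
      linarith
    · simp only [Term.pol]
      have := two_le_pol N
      nlinarith
  | @SPApp2 x M₁ M₂ N hx =>
    right
    simp only [linear_sub_iff, linear_app_iff, Term.fv] at hM
    have hx₁ : x ∉ fv M₁ := by grind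
    have h0 := hM.1.1.mult_eq_zero hx₁
    refine ⟨?_, fun u => ?_, ?_, .inr ?_⟩
    · rintro n Γ F ⟨S, a, b, hab, hS, ⟨A, a', b', hab', h, h'⟩, hb⟩
      refine ⟨A, a', b' + b, by omega, h.congr le_rfl fun u hu => ?_,
        h'.sub_of_disjoint hM.1.2.1 hx (by grind) hb⟩
      rw [update_of_ne (ne_of_mem_of_not_mem hu hx₁)]
    · simp only [Term.mult, h0]
      grind
    · simp only [Term.cplx, Term.mult, h0]
      linarith
    · simp only [Term.pol]
      have := two_le_pol N
      nlinarith
  | @SPLam x y M N hxy hy =>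
    right
    have h0 := (linear_sub_iff.1 hM).2.1.mult_eq_zero hy
    refine ⟨?_, fun u => ?_, ?_, .inr ?_⟩
    · rintro n Γ G ⟨S, a, b, hab, hS, ⟨A, F, rfl, h⟩, hb⟩
      rw [update_comm hxy] at h
      exact ⟨A, F, rfl, S, a, b, hab, hS, h, (Bag.update_iff hy).2 hb⟩
    · simp only [Term.mult]
      grind
    · simp only [Term.cplx, Term.mult, if_neg hxy, le_refl]
    · simp only [Term.pol]
      have := two_le_pol N
      nlinarith
  | @SPWeak x y M N hxy =>
    right
    refine ⟨?_, fun u => ?_, ?_, .inr ?_⟩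
    · rintro n Γ F ⟨S, a, b, hab, hS, ⟨hy, h⟩, hb⟩
      rw [update_of_ne hxy.symm] at hy
      exact ⟨hy, S, a, b, hab, hS, h, hb⟩
    · simp only [Term.mult]
      grind
    · simp only [Term.cplx, Term.mult, if_neg hxy, le_refl]
    · simp only [Term.pol]
      have := two_le_pol N
      nlinarith
  | @SPSub x y M₁ M₂ N hx =>
    right
    have hM₀ := hM
    simp only [linear_sub_iff, Term.fv] at hM
    have h0 : x ≠ y → x ∉ fv M₁ := by grind
    have h0' : (if x = y then 0 else Term.mult M₁ x) = 0 := by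
      split_ifs with e
      · rfl
      · exact hM.1.1.mult_eq_zero (h0 e)
    refine ⟨?_, fun u => ?_, ?_, .inr ?_⟩
    · rintro n Γ F ⟨S, a, b, hab, hS, ⟨T, a', b', hab', hT, h, h'⟩, hb⟩
      refine ⟨T, a', b' + b, by omega, hT,
        h.congr le_rfl fun u hu => update_le_update _ fun hy => ?_,
        h'.sub_of_disjoint hM.1.2.1 hx (by grind) hb⟩
      rw [update_of_ne (by grind)]
    · simp only [Term.mult, h0', if_pos hx, Term.fv]
      have h₁ := hM.1.2.1.mult_eq_zero (u := u)
      have h₂ := hM.2.1.mult_eq_zero (u := u)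
      by_cases hux : u = x
      · subst hux
        simp only [if_true, if_pos hx, h0']
        by_cases huN : u ∈ fv N
        · simp only [huN, Finset.mem_union, or_true, if_true]
          nlinarith [Nat.zero_le (Term.mult M₁ y * Term.mult M₂ u * (Term.mult N u + 1))]
        · simp [huN]
      · by_cases huN : u ∈ fv N
        · have huM₂ : u ∉ fv M₂ := by grind
          simp only [huN, huM₂, hux, Finset.mem_union, or_true, if_true, if_false, h₁ huM₂]
          nlinarith [Nat.zero_le (Term.mult M₁ y * Term.mult M₂ x * (Term.mult N u + 1)),
            Nat.zero_le (Term.mult M₁ y * Term.mult N u)]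
        · simp [huN, hux]
    · simp only [Term.cplx, Term.mult, h0', if_pos hx]
      nlinarith [Nat.zero_le (Term.mult M₁ y * Term.cplx N)]
    · simp only [Term.pol]
      have h₁ := two_le_pol N
      have h₂ := two_le_pol M₁
      nlinarith [Nat.zero_le (pol M₁ * pol N)]
  | @W x M N X hX hN =>
    right
    have hmem : ∀ u, u ∈ X ↔ u ∈ fv N := by simp [← hN]
    simp only [linear_sub_iff, linear_weak_iff, Term.fv] at hM
    have hlt : Term.cplx (weaks X M) < Term.cplx (sub (weak x M) x N) := by
      rw [cplx_weaks]
      simp only [Term.cplx, Term.mult, if_true]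
      have := one_le_cplx N
      omega
    refine ⟨?_, fun u => ?_, hlt.le, .inl hlt⟩
    · rintro n Γ F ⟨S, a, b, hab, hS, ⟨-, h⟩, hb⟩
      refine ty_weaks (fun u hu => hb.ne_zero hM.2.1 hS ((hmem u).1 hu))
        (h.congr (by omega) fun u hu => ?_)
      rw [update_of_ne (ne_of_mem_of_not_mem hu hM.1.2)]
    · rw [mult_weaks]
      simp only [hmem, Term.mult, if_true]
      have := hM.1.1.mult_eq_zero hM.1.2
      grind
  | D h₁ h₂ h₃ h₄ => exact .inr ((isDuplicate_swaps h₁ h₂ h₃ h₄).propagates hM)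
  | @WAbs x y M hxy =>
    right
    refine ⟨?_, fun u => ?_, ?_, .inr ?_⟩
    · rintro n Γ G ⟨A, F, rfl, hy, h⟩
      rw [update_of_ne hxy.symm] at hy
      exact ⟨hy, A, F, rfl, h⟩
    · simp only [Term.mult]
      grind
    · exact le_rfl
    · simp only [Term.pol]
      omega
  | @WApp1 y M N =>
    right
    simp only [linear_app_iff, linear_weak_iff, Term.fv] at hM
    refine ⟨?_, fun u => ?_, ?_, .inr ?_⟩
    · rintro n Γ F ⟨A, a, b, hab, ⟨hy, h⟩, hb⟩
      exact ⟨hy, A, a, b, hab, h, hb⟩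
    · simp only [Term.mult]
      grind
    · exact le_rfl
    · simp only [Term.pol]
      omega
  | @WApp2 y M N =>
    right
    refine ⟨?_, fun u => ?_, ?_, .inr ?_⟩
    · rintro n Γ F ⟨A, a, b, hab, h, hb⟩
      exact ⟨hb.apply_ne_zero A.ms_ne_zero fun _ _ _ h => h.1, A, a, b, hab, h,
        hb.imp fun _ _ _ h => h.2⟩
    · simp only [Term.mult]
      grind
    · exact le_rfl
    · simp only [Term.pol]
      omega
  | @WSubs x y M N =>
    right
    simp only [linear_sub_iff, linear_weak_iff, Term.fv] at hM
    refine ⟨?_, fun u => ?_, ?_, .inr ?_⟩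
    · rintro n Γ F ⟨S, a, b, hab, hS, h, hb⟩
      exact ⟨hb.apply_ne_zero hS fun _ _ _ h => h.1, S, a, b, hab, hS, h,
        hb.imp fun _ _ _ h => h.2⟩
    · have := hM.1.mult_pos hM.2.2.1
      simp only [Term.mult, Term.fv, Finset.mem_union, Finset.mem_singleton]
      by_cases huy : u = y
      · simp only [huy, or_true, if_true]
        grind
      · grind
    · exact le_rfl
    · simp only [Term.pol]
      have := two_le_pol M
      nlinarith
  | @Merge w y z M hw =>
    right
    simp only [linear_contr_iff, linear_weak_iff, Term.fv] at hM
    refine ⟨?_, fun u => ?_, ?_, .inr ?_⟩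
    · rintro n Γ F ⟨S, T, hST, -, h⟩
      have : Ty (swap z w M) n (update Γ w (Γ w)) F := by
        rw [ty_swap hw]
        refine h.congr le_rfl fun u hu => ?_
        have huy : u ≠ y := ne_of_mem_of_not_mem hu hM.1.2
        by_cases huz : u = z
        · subst huz
          simpa using (le_add_of_nonneg_left zero_le).trans hST
        · simp [huy, huz]
      simpa using this
    · have h₁ := hM.1.1.mult_eq_zero hM.1.2
      have h₂ := hM.1.1.mult_eq_zero hw
      rw [mult_swap]
      simp only [Term.mult, Equiv.swap_apply_def]
      grind
    · simp [Term.cplx, swap]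
    · simp only [Term.pol, swap, pol_perm]
      omega
  | @Cross w x y z M hxy hxz =>
    right
    simp only [linear_contr_iff, linear_weak_iff, Term.fv] at hM
    refine ⟨?_, fun u => ?_, ?_, .inr ?_⟩
    · rintro n Γ F ⟨S, T, hST, hx, h⟩
      rw [update_of_ne hxz, update_of_ne hxy] at hx
      exact ⟨hx, S, T, hST, h⟩
    · simp only [Term.mult]
      grind
    · exact le_rfl
    · simp only [Term.pol]
      omega
  | @CAbs w x y z M hxw hxy hxz =>
    right
    refine ⟨?_, fun u => ?_, ?_, .inr ?_⟩
    · rintro n Γ G ⟨S, T, hST, A, F, rfl, h⟩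
      rw [update_comm hxz.symm, update_comm hxy.symm] at h
      exact ⟨A, F, rfl, S, T, by rwa [update_of_ne hxw.symm], h⟩
    · simp only [Term.mult]
      grind
    · exact le_rfl
    · simp only [Term.pol]
      omega
  | @CApp1 w y z M N hy hz =>
    right
    simp only [linear_contr_iff, linear_app_iff, Term.fv] at hM
    have hyN : y ∉ fv N := by grind
    have hzN : z ∉ fv N := by grind
    have h₁ := hM.1.2.1.mult_eq_zero hyN
    have h₂ := hM.1.2.1.mult_eq_zero hzN
    refine ⟨?_, fun u => ?_, ?_, .inr ?_⟩
    · rintro n Γ F ⟨S, T, hST, A, a, b, hab, h, hb⟩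
      rw [Bag.update_iff hzN, Bag.update_iff hyN] at hb
      exact ⟨A, a, b, hab, ⟨S, T, hST, h⟩, hb⟩
    · have h₃ := hM.1.2.1.mult_eq_zero (u := w) (by grind)
      simp only [Term.mult, h₁, h₂]
      grind
    · exact le_rfl
    · simp only [Term.pol]
      omega
  | @CApp2 w y z M N hy hz =>
    right
    simp only [linear_contr_iff, linear_app_iff, Term.fv] at hM
    have hyM : y ∉ fv M := by grind
    have hzM : z ∉ fv M := by grind
    have h₁ := hM.1.1.mult_eq_zero hyM
    have h₂ := hM.1.1.mult_eq_zero hzM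
    refine ⟨?_, fun u => ?_, ?_, .inr ?_⟩
    · rintro n Γ F ⟨S, T, hST, A, a, b, hab, h, hb⟩
      refine ⟨A, a, b, hab, h.congr le_rfl fun u hu => ?_, hb.contr (by grind) hy hM.2.1 hST⟩
      rw [update_of_ne (ne_of_mem_of_not_mem hu hzM), update_of_ne (ne_of_mem_of_not_mem hu hyM)]
    · have h₃ := hM.1.1.mult_eq_zero (u := w) (by grind)
      simp only [Term.mult, h₁, h₂]
      grind
    · exact le_rfl
    · simp only [Term.pol]
      omega
  | @CSubs w x y z M N hy hz =>
    right
    simp only [linear_contr_iff, linear_sub_iff, Term.fv] at hM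
    have hyM : y ≠ x → y ∉ fv M := by grind
    have hzM : z ≠ x → z ∉ fv M := by grind
    refine ⟨?_, fun u => ?_, ?_, .inr ?_⟩
    · rintro n Γ F ⟨S, T, hST, S', a, b, hab, hS', h, hb⟩
      refine ⟨S', a, b, hab, hS', h.congr le_rfl fun u hu => update_le_update _ fun hux => ?_,
        hb.contr (by grind) hy hM.2.1 hST⟩
      rw [update_of_ne (by grind), update_of_ne (by grind)]
    · have hwM : w ≠ x → Term.mult M w = 0 := fun h => hM.1.1.mult_eq_zero (by grind)
      have hyM' : y ≠ x → Term.mult M y = 0 := fun h => hM.1.1.mult_eq_zero (hyM h)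
      have hzM' : z ≠ x → Term.mult M z = 0 := fun h => hM.1.1.mult_eq_zero (hzM h)
      have hwN : w ∉ fv N := by grind
      have hmem := mem_fv_contr (x := w) (z := z) (u := u) hy
      simp only [Term.mult, if_pos hy, if_pos hz, hmem]
      by_cases huw : u = w
      · subst huw
        simp only [or_true, if_true]
        have : (if u = x then 0 else Term.mult M u) = 0 := by grind
        rw [this]
        generalize (if y = x then 0 else Term.mult M y) = k
        generalize (if z = x then 0 else Term.mult M z) = l
        linarith
      · grind
    · exact le_rfl
    · simp only [Term.pol]
      have := two_le_pol M
      nlinarith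

theorem linear_of_ctxt (h : Ctxt RedRule M M') (hM : Linear M) : Linear M' ∧ fv M' = fv M := by
  induction h with
  | base h => exact h.linear hM
  | lam x _ ih =>
    rw [linear_lam_iff] at hM
    obtain ⟨h₁, h₂⟩ := ih hM.1
    exact ⟨.lam h₁ (h₂ ▸ hM.2), by simp only [fv, h₂]⟩
  | appL N _ ih =>
    rw [linear_app_iff] at hM
    obtain ⟨h₁, h₂⟩ := ih hM.1
    exact ⟨linear_app_iff.2 ⟨h₁, h₂ ▸ hM.2⟩, by simp only [fv, h₂]⟩
  | appR N _ ih =>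
    rw [linear_app_iff] at hM
    obtain ⟨h₁, h₂⟩ := ih hM.2.1
    exact ⟨linear_app_iff.2 ⟨hM.1, h₁, h₂ ▸ hM.2.2⟩, by simp only [fv, h₂]⟩
  | subL x N _ ih =>
    rw [linear_sub_iff] at hM
    obtain ⟨h₁, h₂⟩ := ih hM.1
    exact ⟨linear_sub_iff.2 ⟨h₁, h₂ ▸ hM.2⟩, by simp only [fv, h₂]⟩
  | subR M x _ ih =>
    rw [linear_sub_iff] at hM
    obtain ⟨h₁, h₂⟩ := ih hM.2.1
    exact ⟨linear_sub_iff.2 ⟨hM.1, h₁, h₂ ▸ hM.2.2⟩, by simp only [fv, h₂]⟩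
  | weak x _ ih =>
    rw [linear_weak_iff] at hM
    obtain ⟨h₁, h₂⟩ := ih hM.1
    exact ⟨linear_weak_iff.2 ⟨h₁, h₂ ▸ hM.2⟩, by simp only [fv, h₂]⟩
  | contr x y z _ ih =>
    rw [linear_contr_iff] at hM
    obtain ⟨h₁, h₂⟩ := ih hM.1
    exact ⟨linear_contr_iff.2 ⟨h₁, h₂ ▸ hM.2⟩, by simp only [fv, h₂]⟩

/-- A reduction step from a linear term either decreases the size of every typing, or preserves
typings and decreases the two other measures. -/
theorem ty_or_of_ctxt (h : Ctxt RedRule M M') (hM : Linear M) :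
    (∀ n Γ F, Ty M n Γ F → ∃ m < n, Ty M' m Γ F) ∨ Propagates M M' := by
  induction h with
  | base h => exact h.ty_or hM
  | lam x _ ih =>
    rcases ih (linear_lam_iff.1 hM).1 with ih | ih
    · left
      rintro n Γ G ⟨A, F, rfl, h⟩
      obtain ⟨m, hm, h⟩ := ih _ _ _ h
      exact ⟨m, hm, A, F, rfl, h⟩
    · right
      refine ⟨?_, fun u => ?_, ih.cplx, ih.lt.imp id fun h => ?_⟩
      · rintro n Γ G ⟨A, F, rfl, h⟩
        exact ⟨A, F, rfl, ih.ty _ _ _ h⟩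
      · have := ih.mult u
        simp only [Term.mult]
        grind
      · simp only [pol]
        omega
  | appL N _ ih =>
    rcases ih (linear_app_iff.1 hM).1 with ih | ih
    · left
      rintro n Γ F ⟨A, a, b, hab, h, hb⟩
      obtain ⟨m, hm, h⟩ := ih _ _ _ h
      exact ⟨m + b + 1, by omega, A, m, b, le_rfl, h, hb⟩
    · right
      refine ⟨?_, fun u => ?_, ?_, ih.lt.imp (fun h => ?_) fun h => ?_⟩
      · rintro n Γ F ⟨A, a, b, hab, h, hb⟩
        exact ⟨A, a, b, hab, ih.ty _ _ _ h, hb⟩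
      · exact Nat.add_le_add_right (ih.mult u) _
      · exact Nat.add_le_add_right ih.cplx _
      · exact Nat.add_lt_add_right h _
      · simp only [pol]
        omega
  | appR N _ ih =>
    rcases ih (linear_app_iff.1 hM).2.1 with ih | ih
    · left
      rintro n Γ F ⟨A, a, b, hab, h, hb⟩
      obtain ⟨m, hm, hb⟩ := hb.imp_lt A.ms_ne_zero ih
      exact ⟨a + m + 1, by omega, A, a, m, le_rfl, h, hb⟩
    · right
      refine ⟨?_, fun u => ?_, ?_, ih.lt.imp (fun h => ?_) fun h => ?_⟩
      · rintro n Γ F ⟨A, a, b, hab, h, hb⟩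
        exact ⟨A, a, b, hab, h, hb.imp ih.ty⟩
      · exact Nat.add_le_add_left (ih.mult u) _
      · exact Nat.add_le_add_left ih.cplx _
      · exact Nat.add_lt_add_left h _
      · simp only [pol]
        omega
  | subL x N _ ih =>
    rcases ih (linear_sub_iff.1 hM).1 with ih | ih
    · left
      rintro n Γ F ⟨S, a, b, hab, hS, h, hb⟩
      obtain ⟨m, hm, h⟩ := ih _ _ _ h
      exact ⟨m + b, by omega, S, m, b, le_rfl, hS, h, hb⟩
    · right
      have hx := Nat.mul_le_mul_right (Term.cplx N) (ih.mult x)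
      refine ⟨?_, fun u => ?_, ?_, ih.lt.imp (fun h => ?_) fun h => ?_⟩
      · rintro n Γ F ⟨S, a, b, hab, hS, h, hb⟩
        exact ⟨S, a, b, hab, hS, ih.ty _ _ _ h, hb⟩
      · simp only [Term.mult]
        refine Nat.add_le_add ?_ ?_
        · split_ifs
          · exact le_rfl
          · exact ih.mult u
        · split_ifs
          · exact Nat.mul_le_mul_right _ (ih.mult x)
          · exact le_rfl
      · exact Nat.add_le_add ih.cplx hx
      · exact Nat.add_lt_add_of_lt_of_le h hx
      · exact Nat.mul_lt_mul_of_pos_right h (Nat.succ_pos _)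
  | @subR M x N N' hR ih =>
    have hM' := linear_sub_iff.1 hM
    rcases ih hM'.2.1 with ih | ih
    · left
      rintro n Γ F ⟨S, a, b, hab, hS, h, hb⟩
      obtain ⟨m, hm, hb⟩ := hb.imp_lt hS ih
      exact ⟨a + m, by omega, S, a, m, le_rfl, hS, h, hb⟩
    · right
      refine ⟨?_, fun u => ?_, ?_, ih.lt.imp (fun h => ?_) fun h => ?_⟩
      · rintro n Γ F ⟨S, a, b, hab, hS, h, hb⟩
        exact ⟨S, a, b, hab, hS, h, hb.imp ih.ty⟩
      · simp only [Term.mult, (linear_of_ctxt hR hM'.2.1).2]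
        refine Nat.add_le_add_left ?_ _
        split_ifs
        · exact Nat.mul_le_mul_left _ (Nat.succ_le_succ (ih.mult u))
        · exact le_rfl
      · exact Nat.add_le_add_left (Nat.mul_le_mul_left _ ih.cplx) _
      · exact Nat.add_lt_add_left (Nat.mul_lt_mul_of_pos_left h (hM'.1.mult_pos hM'.2.2.1)) _
      · exact Nat.mul_lt_mul_of_pos_left (Nat.succ_lt_succ h)
          (lt_of_lt_of_le Nat.zero_lt_two (two_le_pol M))
  | weak x _ ih =>
    rcases ih (linear_weak_iff.1 hM).1 with ih | ih
    · left
      rintro n Γ F ⟨hx, h⟩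
      obtain ⟨m, hm, h⟩ := ih _ _ _ h
      exact ⟨m, hm, hx, h⟩
    · right
      refine ⟨fun n Γ F h => ⟨h.1, ih.ty _ _ _ h.2⟩, fun u => ?_, ih.cplx,
        ih.lt.imp id fun h => ?_⟩
      · have := ih.mult u
        simp only [Term.mult]
        grind
      · exact Nat.succ_lt_succ h
  | contr x y z _ ih =>
    rcases ih (linear_contr_iff.1 hM).1 with ih | ih
    · left
      rintro n Γ F ⟨S, T, hST, h⟩
      obtain ⟨m, hm, h⟩ := ih _ _ _ h
      exact ⟨m, hm, S, T, hST, h⟩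
    · right
      refine ⟨?_, fun u => ?_, ih.cplx, ih.lt.imp id fun h => ?_⟩
      · rintro n Γ F ⟨S, T, hST, h⟩
        exact ⟨S, T, hST, ih.ty _ _ _ h⟩
      · have h₁ := ih.mult u
        have h₂ := ih.mult y
        have h₃ := ih.mult z
        simp only [Term.mult]
        grind
      · simp only [pol]
        omega

/-! ### Strong normalisation -/

/-- Strong normalisation of a typable linear term, by induction on the lexicographically ordered
measures. -/
theorem sn_of_ty (hM : Linear M) {n : ℕ} {Γ : MCx} {F : FTy} (h : Ty M n Γ F) : SN M := by
  have key : ∀ p : ℕ ×ₗ ℕ ×ₗ ℕ, ∀ M n, p = toLex (n, toLex (cplx M, pol M)) → Linear M →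
      Ty M n Γ F → SN M := by
    intro p
    induction p using WellFoundedLT.induction with
    | ind p ih =>
      rintro M n rfl hM h
      refine Acc.intro _ fun M' hR => ?_
      obtain ⟨P, Q, hMP, hPQ, hQM'⟩ := hR
      have hP := hMP.sim.1.1 hM
      have hMP := hMP.sim.2 hM
      have hQ := (linear_of_ctxt hPQ hP).1
      have hM' := hQM'.sim.1.1 hQ
      have hQM' := hQM'.sim.2 hQ
      rw [hMP.ty] at h
      rw [hMP.cplx, hMP.pol] at ih
      rcases ty_or_of_ctxt hPQ hP with hlt | hlex
      · obtain ⟨m, hm, h⟩ := hlt _ _ _ h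
        exact ih _ (Prod.Lex.toLex_lt_toLex.2 (.inl hm)) M' m rfl hM' (hQM'.ty ▸ h)
      · refine ih (toLex (n, toLex (cplx M', pol M')))
          (Prod.Lex.toLex_lt_toLex.2 (.inr ⟨rfl, Prod.Lex.toLex_lt_toLex.2 ?_⟩)) M' n rfl hM'
          (hQM'.ty ▸ hlex.ty _ _ _ h)
        have h₁ := hlex.cplx
        have h₂ := hlex.lt
        rw [hQM'.cplx, hQM'.pol] at h₂
        rw [hQM'.cplx] at h₁
        rcases h₁.lt_or_eq with h₁ | h₁
        · exact .inl h₁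
        · exact .inr ⟨h₁, h₂.resolve_left (by omega)⟩
  exact key _ M n rfl hM h

end Term
end Lxr

theorem mainTheorem7 (M : Lxr.Term) (hM : M.Linear) (Γ : Lxr.Cx) (A : Lxr.ATy)
    (h : Lxr.Derives Γ M (Lxr.UTy.a A)) : M.SN := by
  obtain ⟨n, h⟩ := h.exists_bag
  -- The typing of one component of the intersection `A` suffices.
  obtain ⟨F, hF⟩ := Multiset.exists_mem_of_ne_zero A.ms_ne_zero
  obtain ⟨m, Δ, -, -, h⟩ := h.exists_of_mem hF
  exact Lxr.Term.sn_of_ty hM h
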